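/- Let $k\ge 1$ be an integer and let $\beta=(\beta_{i,j})_{i,j\in\mathbb Z_{\ge0},\,i+j\le 2k}$ be a real bivariate sequence of degree $2k$. A positive Borel measure $\mu$ on $\mathbb R^2$ *represents* $\beta$ if $\beta_{i,j}=\int x^iy^j\,d\mu$ (with integrable monomials) for all $i+j\le 2k$; it is *supported on* the curve $y^2=x^3$ if the complement of $\{(x,y):y^2=x^3\}$ is $\mu$-null; it is *$n$-atomic* if it is a sum of point masses with positive densities at $n$ distinct points (for $n=0$ it is the zero measure). Let $M(k)=(\beta_{i+i',j+j'})$ be the moment matrix, with rows and columns indexed by the monomials $X^iY^j$, $i+j\le k$. For $p=\sum a_{ij}x^iy^j$ of degree at most $k$, write $p(X,Y)=\sum a_{ij}X^iY^j$ for the corresponding linear combination of the columns of $M(k)$; the relation $p(X,Y)=0$ is called a column relation of $M(k)$. $M(k)$ is *recursively generated* if for all $p,q$ with $\deg p,\deg q,\deg(pq)\le k$, $p(X,Y)=0$ implies $(pq)(X,Y)=0$. For a real sequence $s=(s_0,\dots,s_{2d})$ let $A_s=(s_{i+j})_{i,j=0}^d$ be its Hankel matrix, with columns $\mathbf v_0,\dots,\mathbf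 v_d$, and let $\operatorname{Rank}s=d+1$ if $A_s$ is nonsingular and $\operatorname{Rank}s=\min\{i:\mathbf v_i\in\operatorname{span}\{\mathbf v_0,\dots,\mathbf v_{i-1}\}\}$ if $A_s$ is singular. Put $$u^{(i)}=(\beta_{1,i},\beta_{0,i+1},\beta_{2,i})\quad(0\le i\le 2k-2),$$ $$\widehat\beta=(u^{(0)},\dots,u^{(2k-2)}),\quad \widetilde\beta=(\widehat\beta,\beta_{1,2k-1},\beta_{0,2k}),\quad \overline\beta=(\beta_{2,0},u^{(1)},\dots,u^{(2k-2)}),\quad \breve\beta=(\overline\beta,\beta_{1,2k-1},\beta_{0,2k}),$$ $$v=(u^{(0)},\dots,u^{(k-2)},\beta_{1,k-1}),\qquad \widetilde A=\begin{pmatrix}\beta_{0,0}&v\\ v^T&A_{\overline\beta}\end{pmatrix}.$$ Suppose that $M(k)$ is positive semidefinite and recursively generated. Then $\beta$ has a representing measure supported on $y^2=x^3$ if and only if both of the following hold. 1. One of the following holds: $k\ge3$ and $Y^2=X^3$ is a column relation of $M(k)$; or $k=2$ and $\beta_{0,2}=\beta_{3,0}$, $\beta_{1,2}=\beta_{4,0}$,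 $\beta_{0,3}=\beta_{3,1}$; or $k=1$. 2. One of the following holds: (a) $A_{\widetilde\beta}\succ0$ and $\widetilde A\succ0$; (b) $A_{\widetilde\beta}\succeq0$ and $\operatorname{Rank}A_{\widehat\beta}=\operatorname{Rank}A_{\widetilde\beta}=\operatorname{Rank}A_{\breve\beta}$. Moreover, suppose that such a measure exists. If (a) holds, or if (b) holds with $\operatorname{Rank}A_{\widehat\beta}=\operatorname{Rank}M(k)$, then there is a $(\operatorname{Rank}\widetilde\beta)$-atomic representing measure supported on $y^2=x^3$, and none with fewer atoms. Otherwise there is a $(\operatorname{Rank}\widetilde\beta+1)$-atomic representing measure supported on $y^2=x^3$, and none with fewer atoms. -/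

import Mathlib

/-! Throughout, a bivariate sequence of degree `2 * k` is given as a function `β : ℕ → ℕ → ℝ`, of
which only the values `β i j` with `i + j ≤ 2 * k` are ever used. -/

noncomputable section

namespace CuspTMP

/-- The exponents `(i, j)` of the monomials `X ^ i * Y ^ j` of degree at most `k`. -/
abbrev MonIdx (k : ℕ) : Type :=
  {p : Fin (k + 1) × Fin (k + 1) // (p.1 : ℕ) + (p.2 : ℕ) ≤ k}

/-- The moment matrix `M(k)`, with rows and columns indexed by the monomials of degree at most `k`:
the entry in row `X ^ i * Y ^ j` and column `X ^ i' * Y ^ j'` is `β (i + i') (j + j')`. -/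
def momentMatrix (β : ℕ → ℕ → ℝ) (k : ℕ) : Matrix (MonIdx k) (MonIdx k) ℝ :=
  Matrix.of fun r c => β (r.1.1 + c.1.1) (r.1.2 + c.1.2)

/-- The vector of coefficients of a bivariate polynomial (`X` is the variable `0`, `Y` is the
variable `1`) at the monomials of degree at most `k`. -/
def coeffVec (k : ℕ) (p : MvPolynomial (Fin 2) ℝ) : MonIdx k → ℝ := fun c =>
  p.coeff (Finsupp.single 0 (c.1.1 : ℕ) + Finsupp.single 1 (c.1.2 : ℕ))

/-- For `p = ∑ a_ij x ^ i y ^ j` of degree at most `k`, the vector `p(X, Y) = ∑ a_ij X ^ i Y ^ j`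
in the column space of `M(k)`, where `X ^ i Y ^ j` stands for the corresponding column. -/
def colVec (β : ℕ → ℕ → ℝ) (k : ℕ) (p : MvPolynomial (Fin 2) ℝ) : MonIdx k → ℝ :=
  (momentMatrix β k).mulVec (coeffVec k p)

/-- `M(k)` is recursively generated. -/
def RecursivelyGenerated (β : ℕ → ℕ → ℝ) (k : ℕ) : Prop :=
  ∀ p q : MvPolynomial (Fin 2) ℝ,
    p.totalDegree ≤ k → q.totalDegree ≤ k → (p * q).totalDegree ≤ k →
    colVec β k p = 0 → colVec β k (p * q) = 0

/-- The polynomial `y² - x³`. -/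
def cuspPoly : MvPolynomial (Fin 2) ℝ := MvPolynomial.X 1 ^ 2 - MvPolynomial.X 0 ^ 3

/-- The curve `y² = x³` in the real plane. -/
def cusp : Set (ℝ × ℝ) := {z | z.2 ^ 2 = z.1 ^ 3}

/-- The (positive Borel) measure `μ` represents `β` up to degree `2 * k` and is supported on the
closed set `K`. The moment `β 0 0` makes `μ` finite. -/
def IsRepMeasure (β : ℕ → ℕ → ℝ) (k : ℕ) (K : Set (ℝ × ℝ))
    (μ : MeasureTheory.Measure (ℝ × ℝ)) : Prop :=
  μ Kᶜ = 0 ∧ ∀ i j : ℕ, i + j ≤ 2 * k →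
    MeasureTheory.Integrable (fun z : ℝ × ℝ => z.1 ^ i * z.2 ^ j) μ ∧
      ∫ z : ℝ × ℝ, z.1 ^ i * z.2 ^ j ∂μ = β i j

/-- `μ` is `n`-atomic: a sum of point masses with positive densities at `n` distinct points. -/
def IsAtomicMeasure (n : ℕ) (μ : MeasureTheory.Measure (ℝ × ℝ)) : Prop :=
  ∃ (s : Finset (ℝ × ℝ)) (w : ℝ × ℝ → ℝ), s.card = n ∧ (∀ z ∈ s, 0 < w z) ∧
    μ = ∑ z ∈ s, ENNReal.ofReal (w z) • MeasureTheory.Measure.dirac z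

/-- The Hankel matrix `A_s = (s (i + j))`, `0 ≤ i, j ≤ d`, of the finite sequence
`(s 0, …, s (2 * d))`. -/
def hankel (s : ℕ → ℝ) (d : ℕ) : Matrix (Fin (d + 1)) (Fin (d + 1)) ℝ :=
  Matrix.of fun i j => s (i + j)

/-- The vector `(s j, …, s (j + d))`; for `j ≤ d` it is a column of `hankel s d`. -/
def hankelCol (s : ℕ → ℝ) (d j : ℕ) : Fin (d + 1) → ℝ := fun l => s (j + l)

open Classical in
/-- The rank of the finite sequence `(s 0, …, s (2 * d))`: it is `d + 1` if its Hankel matrix is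
nonsingular, and otherwise the least `i` such that the column with index `i` (counted from `0`) is
in the span of the columns with smaller index. -/
def seqRank (s : ℕ → ℝ) (d : ℕ) : ℕ :=
  if (hankel s d).det ≠ 0 then d + 1
  else sInf {i : ℕ | i ≤ d ∧
    hankelCol s d i ∈ Submodule.span ℝ (hankelCol s d '' {j : ℕ | j < i})}

/-- The triple `u^(i) = (β_{1,i}, β_{0,i+1}, β_{2,i})`. -/
def u (β : ℕ → ℕ → ℝ) (i : ℕ) : Fin 3 → ℝ := ![β 1 i, β 0 (i + 1), β 2 i]

/-- The concatenation of `u^(0), u^(1), u^(2), …`. The sequences below are finite segments of it: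
* `β̂ = (u^(0), …, u^(2k-2))` consists of the terms with index `0, …, 6k-4`;
* `β̃ = (β̂, β_{1,2k-1}, β_{0,2k})` consists of the terms with index `0, …, 6k-2`;
* `β̄ = (β_{2,0}, u^(1), …, u^(2k-2))` consists of the terms with index `2, …, 6k-4`;
* `β̆ = (β̄, β_{1,2k-1}, β_{0,2k})` consists of the terms with index `2, …, 6k-2`. -/
def conc (β : ℕ → ℕ → ℝ) (m : ℕ) : ℝ := u β (m / 3) ⟨m % 3, Nat.mod_lt m (by norm_num)⟩

/-- The Hankel matrix of `β̂`. -/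
def AHat (β : ℕ → ℕ → ℝ) (k : ℕ) := hankel (conc β) (3 * k - 2)

/-- The Hankel matrix of `β̃`. -/
def ATilde (β : ℕ → ℕ → ℝ) (k : ℕ) := hankel (conc β) (3 * k - 1)

/-- The rank of the sequence `β̃`. -/
def rankTilde (β : ℕ → ℕ → ℝ) (k : ℕ) : ℕ := seqRank (conc β) (3 * k - 1)

/-- The Hankel matrix of `β̄`. -/
def ABar (β : ℕ → ℕ → ℝ) (k : ℕ) := hankel (fun m => conc β (m + 2)) (3 * k - 3)

/-- The Hankel matrix of `β̆`. -/
def ABreve (β : ℕ → ℕ → ℝ) (k : ℕ) := hankel (fun m => conc β (m + 2)) (3 * k - 2)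

/-- The vector `v = (u^(0), …, u^(k-2), β_{1,k-1})`, of length `3k - 2`. -/
def vVec (β : ℕ → ℕ → ℝ) (k : ℕ) : Fin (3 * k - 3 + 1) → ℝ := fun i => conc β i

/-- The bordered matrix with rows `(β_{0,0}, v)` and `(vᵀ, A_β̄)`. -/
def tildeA (β : ℕ → ℕ → ℝ) (k : ℕ) :
    Matrix (Unit ⊕ Fin (3 * k - 3 + 1)) (Unit ⊕ Fin (3 * k - 3 + 1)) ℝ :=
  Matrix.fromBlocks (Matrix.of fun _ _ => β 0 0) (Matrix.replicateRow Unit (vVec β k))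
    (Matrix.replicateCol Unit (vVec β k)) (ABar β k)

/-- The numbers `n` for which `β` has an `n`-atomic representing measure supported on the cusp. -/
def atomCounts (β : ℕ → ℕ → ℝ) (k : ℕ) : Set ℕ :=
  {n | ∃ μ : MeasureTheory.Measure (ℝ × ℝ), IsRepMeasure β k cusp μ ∧ IsAtomicMeasure n μ}

end CuspTMP

end

noncomputable section

namespace CuspTMP

open Polynomial

/-! ### Positive functionals on polynomials with nontrivial radical -/

section Quadrature

variable {Λ : ℝ[X] →ₗ[ℝ] ℝ}

/-! The cusp is parametrized by `t ↦ (t ^ 2, t ^ 3)`, which turns `x ^ i * y ^ j` into `t ^ (2 * i +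
3 * j)`; every exponent except `1` occurs. Once condition 1 and recursive generation make `β` a
function of `2 * i + 3 * j` (`FactorsThroughCusp`), the problem is a univariate truncated moment
problem of degree `6k` in which only the moment `c` of order `1` is free. All matrices are then Gram
matrices of powers of `t`: `ATilde` uses `1, …, 3k`, `AHat` omits `3k`, `ABreve` omits `1`, `tildeA`
uses `0, 2, …, 3k - 1`, and `M(k)` uses `0, 2, …, 3k` with repetitions.

Necessity: if `ATilde` is definite, so is `tildeA`, because `f = 0` a.e. implies `t f = 0` a.e.
Otherwise some nonzero polynomial with root `0` and degree at most `3k` vanishes a.e., so there are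
fewer than `3k` nonzero atoms, and the three ranks all count them (`IsAtomicRep.ranks`).

Sufficiency: in case (b) the rank equalities give a monic kernel polynomial and one not vanishing at
`0`; quadrature (`exists_quadrature`) yields nonzero atoms for the moments of order at least `2`,
and `M(k) ⪰ 0` leaves a nonnegative mass at `0`. In case (a), `c` is put at an end of its admissible
interval so that the full Hankel form has a kernel polynomial of degree exactly `3k`
(`exists_singular_completion`).

Minimality: ranks of `M(k)` and `ATilde` bound the number of atoms below. An atom at the origin is
seen by `M(k)` but not by `ATilde`, whence the extra `1`. -/

lemma apply_mul_eq_zero_of_sq (hΛ : ∀ f, 0 ≤ Λ (f * f)) {f : ℝ[X]} (hf : Λ (f * f) = 0)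
    (g : ℝ[X]) : Λ (f * g) = 0 := by
  by_contra h
  have key : ∀ c : ℝ, 0 ≤ 2 * c * Λ (f * g) + Λ (g * g) := fun c => by
    have h1 := hΛ (c • f + g)
    have h2 : (c • f + g) * (c • f + g)
        = (c * c) • (f * f) + (2 * c) • (f * g) + g * g := by
      simp only [smul_eq_C_mul, C_mul, C_ofNat]; ring
    rw [h2, map_add, map_add, map_smul, map_smul, hf] at h1
    simpa using h1
  -- At this `c` the affine function in `key` equals `-1`.
  have h3 := key (-(Λ (g * g) + 1) / (2 * Λ (f * g)))
  have h4 : 2 * (-(Λ (g * g) + 1) / (2 * Λ (f * g))) * Λ (f * g) = -(Λ (g * g) + 1) := by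
    field_simp
  linarith

/-- A positive functional on `ℝ[X]` with nontrivial radical is a positive combination of
finitely many point evaluations. -/
theorem exists_quadrature (hΛ : ∀ f, 0 ≤ Λ (f * f)) {p : ℝ[X]} (hp0 : p ≠ 0)
    (hp : ∀ g, Λ (p * g) = 0) :
    ∃ (T : Finset ℝ) (w : ℝ → ℝ), (∀ t ∈ T, 0 < w t) ∧ (∀ t ∈ T, p.eval t = 0) ∧
      ∀ f, Λ f = ∑ t ∈ T, w t * f.eval t := by
  classical
  -- Take `q` of least degree in the radical; minimality forces its roots to be real and simple, and
  -- they are the candidate nodes.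
  have hex : ∃ n, ∃ q : ℝ[X], q ≠ 0 ∧ (∀ g, Λ (q * g) = 0) ∧ q.natDegree = n :=
    ⟨_, p, hp0, hp, rfl⟩
  obtain ⟨q, hq0, hq, hqn⟩ := Nat.find_spec hex
  have hmin : ∀ f : ℝ[X], f ≠ 0 → Λ (f * f) = 0 → q.natDegree ≤ f.natDegree := by
    intro f hf0 hf
    rw [hqn]
    exact Nat.find_min' hex ⟨f, hf0, apply_mul_eq_zero_of_sq hΛ hf, rfl⟩
  have hsimple : q.roots.Nodup := by
    rw [Multiset.nodup_iff_count_le_one]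
    intro a
    rw [count_roots]
    by_contra h
    obtain ⟨r, hr⟩ := (le_rootMultiplicity_iff hq0).mp (show 2 ≤ rootMultiplicity a q by omega)
    have hr0 : r ≠ 0 := by rintro rfl; simp at hr; exact hq0 hr
    have hXa := X_sub_C_ne_zero a
    -- If `q = (X - a) ^ 2 * r`, the square of `(X - a) * r` is `q * r`, so this polynomial of
    -- smaller degree lies in the radical.
    have h1 := hmin ((X - C a) * r) (mul_ne_zero hXa hr0) (by
      rw [← hq r, hr]; congr 1; ring)
    rw [hr, natDegree_mul (pow_ne_zero 2 hXa) hr0, natDegree_mul hXa hr0] at h1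
    simp at h1
  have hreal : ∀ z : ℂ, aeval z q = 0 → z.im = 0 := by
    intro z hz
    by_contra him
    obtain ⟨r, hr⟩ := quadratic_dvd_of_aeval_eq_zero_im_ne_zero q hz him
    have hr0 : r ≠ 0 := by rintro rfl; simp at hr; exact hq0 hr
    -- A nonreal root makes `q * r` a sum of two squares; both are killed by `Λ`, so `r` would lie
    -- in the radical.
    have hsq : q * r = ((X - C z.re) * r) * ((X - C z.re) * r) + (z.im ^ 2) • (r * r) := by
      rw [hr, Complex.sq_norm, Complex.normSq_apply]
      simp only [smul_eq_C_mul, C_mul, C_add, C_ofNat, C_pow]; ring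
    have h1 := hq r
    rw [hsq, map_add, map_smul, smul_eq_mul] at h1
    have h2 := hΛ ((X - C z.re) * r)
    have h3 := mul_nonneg (sq_nonneg z.im) (hΛ r)
    have h4 : z.im ^ 2 * Λ (r * r) = 0 := by linarith
    have h5 := hmin r hr0 (by
      rcases mul_eq_zero.mp h4 with h | h
      · exact absurd (pow_eq_zero_iff two_ne_zero |>.mp h) him
      · exact h)
    have h6 : (X ^ 2 - C (2 * z.re) * X + C (‖z‖ ^ 2) : ℝ[X]).natDegree = 2 := by
      compute_degree!
    have h7 : (X ^ 2 - C (2 * z.re) * X + C (‖z‖ ^ 2) : ℝ[X]) ≠ 0 := by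
      intro h; rw [h] at h6; simp at h6
    have h8 : q.natDegree = 2 + r.natDegree := by
      conv_lhs => rw [hr, natDegree_mul h7 hr0, h6]
    omega
  have hcard : q.roots.card = q.natDegree := by
    obtain ⟨r, hr, hdeg, hroots⟩ := exists_prod_multiset_X_sub_C_mul q
    by_contra hne
    have hr1 : r.degree ≠ 0 := by
      intro h
      have : r.natDegree = 0 := natDegree_eq_of_degree_eq_some h
      omega
    obtain ⟨z, hz⟩ := Complex.exists_root (f := r.map (algebraMap ℝ ℂ)) (by
      rw [degree_map]
      rcases lt_trichotomy r.degree 0 with h | h | h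
      · rw [Nat.WithBot.lt_zero_iff, degree_eq_bot] at h
        rw [h, mul_zero] at hr; exact absurd hr.symm hq0
      · exact absurd h hr1
      · exact h)
    have hz' : aeval z r = 0 := by rwa [IsRoot, eval_map_algebraMap] at hz
    have him := hreal z (by rw [← hr, map_mul, hz', mul_zero])
    have hzre : z = ((z.re : ℝ) : ℂ) := Complex.ext rfl (by simp [him])
    have hr0 : r ≠ 0 := by rintro rfl; simp at hr; exact hq0 hr.symm
    have : z.re ∈ r.roots := by
      rw [mem_roots hr0, IsRoot]
      rw [hzre] at hz'
      have h2 := aeval_algebraMap_apply ℂ z.re r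
      simp only [Complex.coe_algebraMap, coe_aeval_eq_eval] at h2
      rw [h2] at hz'
      exact_mod_cast hz'
    rw [hroots] at this
    simp at this
  set T := q.roots.toFinset with hT
  have hTcard : T.card = q.natDegree := by
    rw [hT, Multiset.toFinset_card_of_nodup hsimple, hcard]
  have hinj : Set.InjOn (id : ℝ → ℝ) (T : Set ℝ) := Function.injective_id.injOn
  -- `Λ` only sees `f % q`, which is its own Lagrange interpolant at the roots of `q`.
  have hrep : ∀ f, Λ f = ∑ t ∈ T, Λ (Lagrange.basis T id t) * f.eval t := by
    intro f
    have hdeg : (f % q).degree < T.card := by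
      rw [hTcard, ← degree_eq_natDegree hq0]; exact degree_mod_lt f hq0
    have h1 := Lagrange.eq_interpolate hinj hdeg
    have h2 : ∀ t ∈ T, (f % q).eval t = f.eval t := by
      intro t ht
      have h3 : q.eval t = 0 := (mem_roots hq0).mp (Multiset.mem_toFinset.mp ht)
      conv_rhs => rw [← EuclideanDomain.div_add_mod f q]
      simp [h3]
    conv_lhs => rw [← EuclideanDomain.div_add_mod f q]
    rw [map_add, hq, zero_add, h1, Lagrange.interpolate_apply, map_sum]
    refine Finset.sum_congr rfl fun t ht => ?_
    rw [← smul_eq_C_mul, map_smul, id, h2 t ht, smul_eq_mul, mul_comm]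
  have hw : ∀ t ∈ T, 0 ≤ Λ (Lagrange.basis T id t) := by
    intro t ht
    have h1 := hΛ (Lagrange.basis T id t)
    rw [hrep, Finset.sum_eq_single t] at h1
    · have h2 : eval t (Lagrange.basis T id t) = 1 := Lagrange.eval_basis_self hinj ht
      rwa [eval_mul, h2, mul_one, mul_one] at h1
    · intro s hs hst
      have h2 : eval s (Lagrange.basis T id t) = 0 :=
        Lagrange.eval_basis_of_ne (v := id) hst.symm hs
      rw [eval_mul, h2, mul_zero, mul_zero]
    · exact fun h => absurd ht h
  have hrep' : ∀ f, Λ f = ∑ t ∈ T with 0 < Λ (Lagrange.basis T id t),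
      Λ (Lagrange.basis T id t) * f.eval t := by
    intro f
    rw [hrep, Finset.sum_filter]
    refine Finset.sum_congr rfl fun t ht => ?_
    split_ifs with h
    · rfl
    · rw [le_antisymm (not_lt.mp h) (hw t ht), zero_mul]
  refine ⟨{t ∈ T | 0 < Λ (Lagrange.basis T id t)}, fun t => Λ (Lagrange.basis T id t),
    fun t ht => (Finset.mem_filter.mp ht).2, fun t ht => ?_, hrep'⟩
  -- `Λ (p * p) = 0` is a sum of nonnegative terms, so `p` vanishes at every node of positive
  -- weight.
  have h1 := hp p
  rw [hrep', Finset.sum_eq_zero_iff_of_nonneg] at h1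
  · have h2 := h1 t ht
    have h3 := (Finset.mem_filter.mp ht).2
    rw [eval_mul] at h2
    rcases mul_eq_zero.mp h2 with h | h
    · exact absurd h h3.ne'
    · exact mul_self_eq_zero.mp h
  · intro s hs
    rw [eval_mul]
    exact mul_nonneg (Finset.mem_filter.mp hs).2.le (mul_self_nonneg _)

end Quadrature

/-! ### The Riesz functional of a univariate sequence -/

/-- The linear functional on `ℝ[X]` sending `X ^ n` to `γ n`. -/
def riesz (γ : ℕ → ℝ) : ℝ[X] →ₗ[ℝ] ℝ := lsum fun n => γ n • LinearMap.id

lemma riesz_apply (γ : ℕ → ℝ) (f : ℝ[X]) : riesz γ f = f.sum fun n a => γ n * a := by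
  simp [riesz, lsum_apply]

lemma riesz_eq_sum_support (γ : ℕ → ℝ) (f : ℝ[X]) :
    riesz γ f = ∑ n ∈ f.support, γ n * f.coeff n := by
  rw [riesz_apply, sum_def]

@[simp] lemma riesz_X_pow (γ : ℕ → ℝ) (n : ℕ) : riesz γ (X ^ n) = γ n := by
  rw [riesz_apply, X_pow_eq_monomial, sum_monomial_index _ (fun n a => γ n * a) (mul_zero _),
    mul_one]

lemma riesz_mul_eq_zero {γ : ℕ → ℝ} {p : ℝ[X]} {D : ℕ}
    (h : ∀ j ≤ D, riesz γ (p * X ^ j) = 0) {g : ℝ[X]} (hg : g.natDegree ≤ D) :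
    riesz γ (p * g) = 0 := by
  conv_lhs => rw [g.as_sum_range' (D + 1) (by omega)]
  rw [Finset.mul_sum, map_sum]
  refine Finset.sum_eq_zero fun j hj => ?_
  rw [← C_mul_X_pow_eq_monomial, mul_left_comm, ← smul_eq_C_mul, map_smul,
    h j (by simpa [Nat.lt_succ_iff] using hj), smul_zero]

/-- Truncated version of `exists_quadrature`. -/
theorem exists_quadrature_of_natDegree_le {γ : ℕ → ℝ} {D : ℕ}
    (hpos : ∀ f : ℝ[X], f.natDegree ≤ D → 0 ≤ riesz γ (f * f)) {p : ℝ[X]} (hp : p.Monic)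
    (hpD : p.natDegree = D) (hker : ∀ j ≤ D, riesz γ (p * X ^ j) = 0) :
    ∃ (T : Finset ℝ) (w : ℝ → ℝ), (∀ t ∈ T, 0 < w t) ∧ (∀ t ∈ T, p.eval t = 0) ∧
      ∀ n ≤ 2 * D, γ n = ∑ t ∈ T, w t * t ^ n := by
  have hred : ∀ h : ℝ[X], h.natDegree ≤ 2 * D → riesz γ (h %ₘ p) = riesz γ h := by
    intro h hh
    conv_rhs => rw [← modByMonic_add_div h p, map_add]
    rw [riesz_mul_eq_zero hker, add_zero]
    rw [natDegree_divByMonic _ hp]; omega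
  -- Reduction modulo `p` extends the functional positively to all of `ℝ[X]`, without changing it up
  -- to degree `2 * D`.
  obtain ⟨T, w, hw, hT, hrep⟩ := exists_quadrature (Λ := (riesz γ).comp (modByMonicHom p))
    (p := p) (fun f => by
      have h1 : (f * f) %ₘ p = ((f %ₘ p) * (f %ₘ p)) %ₘ p := mul_modByMonic f f p
      have h2 : (f %ₘ p).natDegree ≤ D := hpD ▸ natDegree_modByMonic_le f hp
      simp only [LinearMap.comp_apply, modByMonicHom_apply]
      rw [h1, hred _ (natDegree_mul_le.trans (by omega))]
      exact hpos _ h2) hp.ne_zero (fun g => by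
      simp only [LinearMap.comp_apply, modByMonicHom_apply]
      rw [(modByMonic_eq_zero_iff_dvd hp).mpr (dvd_mul_right p g), map_zero])
  refine ⟨T, w, hw, hT, fun n hn => ?_⟩
  have h := hrep (X ^ n)
  simp only [LinearMap.comp_apply, modByMonicHom_apply] at h
  rw [hred _ (by rw [natDegree_X_pow]; exact hn)] at h
  simpa using h

end CuspTMP
end

noncomputable section

namespace CuspTMP

open Polynomial

/-! ### Gram matrices of families of monomials -/

section Gram

variable {ι : Type*} [Fintype ι]

/-- The matrix of the bilinear form `(f, g) ↦ riesz γ (f * g)` on the monomials `X ^ ex a`. -/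
def gram (γ : ℕ → ℝ) (ex : ι → ℕ) : Matrix ι ι ℝ := Matrix.of fun a b => γ (ex a + ex b)

/-- The polynomial with coefficients `v a` at the monomials `X ^ ex a`. -/
def expPoly (ex : ι → ℕ) (v : ι → ℝ) : ℝ[X] := ∑ a, C (v a) * X ^ ex a

lemma gram_mulVec (γ : ℕ → ℝ) (ex : ι → ℕ) (v : ι → ℝ) (a : ι) :
    (gram γ ex).mulVec v a = riesz γ (expPoly ex v * X ^ ex a) := by
  simp only [Matrix.mulVec, dotProduct, gram, Matrix.of_apply, expPoly, Finset.sum_mul, map_sum]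
  refine Finset.sum_congr rfl fun b _ => ?_
  rw [mul_assoc, ← pow_add, ← smul_eq_C_mul, map_smul, riesz_X_pow, smul_eq_mul, mul_comm,
    add_comm]

lemma dotProduct_gram_mulVec (γ : ℕ → ℝ) (ex : ι → ℕ) (v : ι → ℝ) :
    v ⬝ᵥ (gram γ ex).mulVec v = riesz γ (expPoly ex v * expPoly ex v) := by
  conv_rhs => enter [2, 2]; rw [expPoly]
  simp only [dotProduct, gram_mulVec, Finset.mul_sum, map_sum]
  refine Finset.sum_congr rfl fun a _ => ?_
  rw [mul_left_comm, ← smul_eq_C_mul, map_smul, smul_eq_mul]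

omit [Fintype ι] in
lemma gram_isHermitian (γ : ℕ → ℝ) (ex : ι → ℕ) : (gram γ ex).IsHermitian := by
  ext a b
  simp [gram, add_comm]

lemma coeff_expPoly {ex : ι → ℕ} (hex : ex.Injective) (v : ι → ℝ) (a : ι) :
    (expPoly ex v).coeff (ex a) = v a := by
  classical
  simp only [expPoly, finsetSum_coeff, coeff_C_mul, coeff_X_pow, hex.eq_iff]
  simp

lemma coeff_expPoly_of_notMem {ex : ι → ℕ} (v : ι → ℝ) {n : ℕ} (hn : ∀ a, ex a ≠ n) :
    (expPoly ex v).coeff n = 0 := by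
  simp only [expPoly, finsetSum_coeff, coeff_C_mul, coeff_X_pow]
  exact Finset.sum_eq_zero fun a _ => by simp [(hn a).symm]

lemma exists_of_mem_support_expPoly {ex : ι → ℕ} {v : ι → ℝ} {n : ℕ}
    (hn : n ∈ (expPoly ex v).support) : ∃ a, ex a = n := by
  by_contra! h
  exact mem_support_iff.mp hn (coeff_expPoly_of_notMem v h)

lemma expPoly_ne_zero {ex : ι → ℕ} (hex : ex.Injective) {v : ι → ℝ} (hv : v ≠ 0) :
    expPoly ex v ≠ 0 := by
  contrapose! hv
  ext a
  rw [← coeff_expPoly hex v a, hv]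
  rfl

lemma eval_expPoly (ex : ι → ℕ) (v : ι → ℝ) (t : ℝ) :
    (expPoly ex v).eval t = ∑ a, v a * t ^ ex a := by
  simp [expPoly, eval_finsetSum]

lemma exists_expPoly_eq {ex : ι → ℕ} (hex : ex.Injective) {f : ℝ[X]}
    (hf : ∀ n ∈ f.support, ∃ a, ex a = n) : ∃ v, expPoly ex v = f := by
  refine ⟨fun a => f.coeff (ex a), ?_⟩
  ext n
  by_cases hn : ∃ a, ex a = n
  · obtain ⟨a, rfl⟩ := hn
    rw [coeff_expPoly hex]
  · rw [coeff_expPoly_of_notMem _ (not_exists.mp hn)]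
    by_contra h
    exact hn (hf n (mem_support_iff.mpr (Ne.symm h)))

lemma riesz_mul_self_nonneg {γ : ℕ → ℝ} {ex : ι → ℕ} (hex : ex.Injective)
    (hG : (gram γ ex).PosSemidef) {f : ℝ[X]} (hf : ∀ n ∈ f.support, ∃ a, ex a = n) :
    0 ≤ riesz γ (f * f) := by
  obtain ⟨v, rfl⟩ := exists_expPoly_eq hex hf
  rw [← dotProduct_gram_mulVec]
  exact hG.dotProduct_mulVec_nonneg v

lemma riesz_mul_self_pos {γ : ℕ → ℝ} {ex : ι → ℕ} (hex : ex.Injective)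
    (hG : (gram γ ex).PosDef) {f : ℝ[X]} (hf : ∀ n ∈ f.support, ∃ a, ex a = n) (hf0 : f ≠ 0) :
    0 < riesz γ (f * f) := by
  obtain ⟨v, rfl⟩ := exists_expPoly_eq hex hf
  rw [← dotProduct_gram_mulVec]
  refine hG.dotProduct_mulVec_pos (x := v) ?_
  rintro rfl
  simp [expPoly] at hf0

lemma gram_posSemidef {γ : ℕ → ℝ} {ex : ι → ℕ}
    (h : ∀ f : ℝ[X], (∀ n ∈ f.support, ∃ a, ex a = n) → 0 ≤ riesz γ (f * f)) :
    (gram γ ex).PosSemidef := by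
  refine .of_dotProduct_mulVec_nonneg (gram_isHermitian γ ex) fun v => ?_
  rw [star_trivial, dotProduct_gram_mulVec]
  exact h _ fun n hn => exists_of_mem_support_expPoly hn

lemma gram_posDef {γ : ℕ → ℝ} {ex : ι → ℕ} (hex : ex.Injective)
    (h : ∀ f : ℝ[X], (∀ n ∈ f.support, ∃ a, ex a = n) → f ≠ 0 → 0 < riesz γ (f * f)) :
    (gram γ ex).PosDef := by
  refine .of_dotProduct_mulVec_pos (gram_isHermitian γ ex) fun v hv => ?_
  rw [star_trivial, dotProduct_gram_mulVec]
  exact h _ (fun n hn => exists_of_mem_support_expPoly hn) (expPoly_ne_zero hex hv)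

lemma riesz_eq_sum_eval {γ : ℕ → ℝ} {T : Finset ℝ} {w : ℝ → ℝ} {f : ℝ[X]}
    (h : ∀ n ∈ f.support, γ n = ∑ t ∈ T, w t * t ^ n) :
    riesz γ f = ∑ t ∈ T, w t * f.eval t := by
  rw [riesz_eq_sum_support]
  simp_rw [eval_eq_sum, sum_def, Finset.mul_sum]
  rw [Finset.sum_comm]
  refine Finset.sum_congr rfl fun n hn => ?_
  rw [h n hn, Finset.sum_mul]
  exact Finset.sum_congr rfl fun t _ => by ring

lemma eval_eq_zero_of_sum_eq_zero {T : Finset ℝ} {w : ℝ → ℝ} (hw : ∀ t ∈ T, 0 < w t)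
    {f : ℝ[X]} (h : ∑ t ∈ T, w t * (f * f).eval t = 0) : ∀ t ∈ T, f.eval t = 0 := by
  intro t ht
  rw [Finset.sum_eq_zero_iff_of_nonneg] at h
  · have h2 := h t ht
    rw [eval_mul] at h2
    rcases mul_eq_zero.mp h2 with h | h
    · exact absurd h (hw t ht).ne'
    · exact mul_self_eq_zero.mp h
  · intro s hs
    rw [eval_mul]
    exact mul_nonneg (hw s hs).le (mul_self_nonneg _)

/-! ### Ranks of Gram matrices of finitely atomic measures -/

/-- The matrix factors through a space with one coordinate per atom. -/
lemma rank_le_card {τ : Type*} {G : Matrix ι ι ℝ} (T : Finset τ) (F F' : τ → ι → ℝ)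
    (h : ∀ a b, G a b = ∑ t ∈ T, F t a * F' t b) : G.rank ≤ T.card := by
  have hG : G = (Matrix.of fun (a : ι) (t : T) => F t a) *
      (Matrix.of fun (t : T) (b : ι) => F' t b) := by
    ext a b
    rw [h, Matrix.mul_apply, ← Finset.sum_coe_sort]
    rfl
  rw [hG]
  refine (Matrix.rank_mul_le_left _ _).trans ((Matrix.rank_le_card_width _).trans ?_)
  simp

/-- The Gram matrix is `Vᵀ * V` for the weighted evaluation matrix `V`, whose rank is full because
the given monomials interpolate arbitrary values on `T`. -/
lemma rank_gram_eq_card {γ : ℕ → ℝ} {ex : ι → ℕ} {T : Finset ℝ} {w : ℝ → ℝ}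
    (hw : ∀ t ∈ T, 0 < w t)
    (hγ : ∀ a b, γ (ex a + ex b) = ∑ t ∈ T, w t * t ^ (ex a + ex b))
    (hsurj : ∀ c : ℝ → ℝ, ∃ v, ∀ t ∈ T, (expPoly ex v).eval t = c t) :
    (gram γ ex).rank = T.card := by
  set V : Matrix T ι ℝ := Matrix.of fun t a => √(w t) * (t : ℝ) ^ ex a with hV
  have hG : gram γ ex = V.transpose * V := by
    ext a b
    rw [gram, Matrix.of_apply, hγ, Matrix.mul_apply, ← Finset.sum_coe_sort]
    refine Finset.sum_congr rfl fun t _ => ?_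
    simp only [hV, Matrix.transpose_apply, Matrix.of_apply]
    have := Real.mul_self_sqrt (hw t t.2).le
    rw [pow_add]
    linear_combination (-(t : ℝ) ^ ex a * (t : ℝ) ^ ex b) * this
  rw [hG, Matrix.rank_transpose_mul_self, Matrix.rank]
  have : LinearMap.range V.mulVecLin = ⊤ := by
    rw [LinearMap.range_eq_top]
    intro c
    classical
    obtain ⟨v, hv⟩ := hsurj fun t => if h : t ∈ T then c ⟨t, h⟩ / √(w t) else 0
    refine ⟨v, ?_⟩
    ext t
    have h1 := hv t t.2
    rw [eval_expPoly, dif_pos t.2] at h1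
    have h2 : √(w t) ≠ 0 := (Real.sqrt_pos.mpr (hw t t.2)).ne'
    rw [eq_div_iff h2, Finset.sum_mul] at h1
    simp only [Matrix.mulVecLin_apply, Matrix.mulVec, dotProduct, hV, Matrix.of_apply]
    refine Eq.trans (Finset.sum_congr rfl fun a _ => ?_) h1
    ring
  rw [this, finrank_top]
  simp

end Gram

/-! ### Interpolation by multiples of a power of `X` -/

lemma exists_natDegree_lt_eval_eq (T : Finset ℝ) (c : ℝ → ℝ) :
    ∃ g : ℝ[X], (∀ n ∈ g.support, n < T.card) ∧ ∀ t ∈ T, g.eval t = c t := by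
  have hinj : Set.InjOn (id : ℝ → ℝ) (T : Set ℝ) := Function.injective_id.injOn
  refine ⟨Lagrange.interpolate T id c, fun n hn => ?_, fun t ht =>
    Lagrange.eval_interpolate_at_node (v := id) c hinj ht⟩
  have h1 := le_degree_of_mem_supp n hn
  exact_mod_cast h1.trans_lt (Lagrange.degree_interpolate_lt (v := id) c hinj)

lemma exists_eval_X_pow_mul_eq {T : Finset ℝ} (hT : 0 ∉ T) (e : ℕ) (c : ℝ → ℝ) :
    ∃ g : ℝ[X], (∀ n ∈ g.support, n < T.card) ∧ ∀ t ∈ T, (X ^ e * g).eval t = c t := by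
  obtain ⟨g, hg, hgc⟩ := exists_natDegree_lt_eval_eq T fun t => c t / t ^ e
  refine ⟨g, hg, fun t ht => ?_⟩
  have : t ≠ 0 := fun h => hT (h ▸ ht)
  rw [eval_mul, hgc t ht, eval_pow, eval_X]
  field_simp

lemma mem_support_X_pow_mul {e n : ℕ} {g : ℝ[X]} (hn : n ∈ (X ^ e * g).support) :
    ∃ m ∈ g.support, n = m + e := by
  rw [mem_support_iff, coeff_X_pow_mul'] at hn
  split_ifs at hn with h
  · exact ⟨n - e, mem_support_iff.mpr hn, by omega⟩
  · exact absurd rfl hn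

/-- The Gram matrix of `X ^ e, …, X ^ (e + N - 1)` for a measure with at most `N` atoms, all of
them nonzero. -/
lemma rank_gram_shift {γ : ℕ → ℝ} {T : Finset ℝ} {w : ℝ → ℝ} (hw : ∀ t ∈ T, 0 < w t)
    (hT : 0 ∉ T) {e N : ℕ} (hN : T.card ≤ N)
    (hγ : ∀ a b : Fin N, γ ((a + e) + (b + e)) = ∑ t ∈ T, w t * t ^ ((a + e) + (b + e) : ℕ)) :
    (gram γ fun a : Fin N => (a : ℕ) + e).rank = T.card := by
  refine rank_gram_eq_card hw hγ fun c => ?_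
  obtain ⟨g, hg, hgc⟩ := exists_eval_X_pow_mul_eq hT e c
  obtain ⟨v, hv⟩ := exists_expPoly_eq (ex := fun a : Fin N => (a : ℕ) + e)
    (fun a b h => by simpa [Fin.ext_iff] using h) (f := X ^ e * g) (fun n hn => by
      obtain ⟨m, hm, rfl⟩ := mem_support_X_pow_mul hn
      exact ⟨⟨m, (hg m hm).trans_le hN⟩, rfl⟩)
  exact ⟨v, by rwa [hv]⟩

/-! ### The rank of a sequence -/

/-- The linear map sending `X ^ j` to the `j`-th Hankel column. -/
def hankelColMap (s : ℕ → ℝ) (d : ℕ) : ℝ[X] →ₗ[ℝ] (Fin (d + 1) → ℝ) :=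
  LinearMap.pi fun l => (riesz s).comp (LinearMap.mulRight ℝ (X ^ (l : ℕ)))

lemma hankelColMap_apply (s : ℕ → ℝ) (d : ℕ) (f : ℝ[X]) (l : Fin (d + 1)) :
    hankelColMap s d f l = riesz s (f * X ^ (l : ℕ)) := rfl

lemma hankelColMap_X_pow (s : ℕ → ℝ) (d j : ℕ) : hankelColMap s d (X ^ j) = hankelCol s d j := by
  ext l
  rw [hankelColMap_apply, ← pow_add, riesz_X_pow, hankelCol]

lemma hankelCol_mem_span_iff (s : ℕ → ℝ) (d i : ℕ) :
    hankelCol s d i ∈ Submodule.span ℝ (hankelCol s d '' {j : ℕ | j < i}) ↔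
      ∃ g : ℝ[X], g.degree < i ∧ hankelColMap s d (X ^ i - g) = 0 := by
  have h1 : hankelCol s d '' {j : ℕ | j < i} =
      hankelColMap s d '' ((Finset.range i).image fun n => (X : ℝ[X]) ^ n : Finset ℝ[X]) := by
    ext z
    simp [hankelColMap_X_pow]
  rw [h1, Submodule.span_image, ← degreeLT_eq_span_X_pow]
  simp only [Submodule.mem_map, mem_degreeLT, map_sub, hankelColMap_X_pow, sub_eq_zero]
  exact exists_congr fun g => and_congr_right fun _ => eq_comm

/-- A relation expressing column `i` through earlier ones is a monic polynomial of degree `i`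
vanishing on `T`; one exists exactly when `i ≥ T.card`. -/
lemma seqRank_eq_card {s : ℕ → ℝ} {d : ℕ} {T : Finset ℝ} {w : ℝ → ℝ} (hw : ∀ t ∈ T, 0 < w t)
    (hs : ∀ n ≤ 2 * d, s n = ∑ t ∈ T, w t * t ^ n) (hT : T.card ≤ d) :
    seqRank s d = T.card := by
  have hriesz : ∀ h : ℝ[X], h.natDegree ≤ 2 * d → riesz s h = ∑ t ∈ T, w t * h.eval t :=
    fun h hh => riesz_eq_sum_eval fun n hn => hs n ((le_natDegree_of_mem_supp n hn).trans hh)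
  have hdet : (hankel s d).det = 0 := by
    by_contra h
    have h1 := Matrix.rank_of_isUnit _ ((Matrix.isUnit_iff_isUnit_det _).mpr (Ne.isUnit h))
    have h2 := rank_le_card (G := hankel s d) T (fun t a => w t * t ^ (a : ℕ))
      (fun t b => t ^ (b : ℕ)) (fun a b => by
        rw [hankel, Matrix.of_apply, hs _ (by omega)]
        exact Finset.sum_congr rfl fun t _ => by ring)
    rw [Fintype.card_fin] at h1
    omega
  rw [seqRank, if_neg (not_not.mpr hdet)]
  have hset : {i : ℕ | i ≤ d ∧
      hankelCol s d i ∈ Submodule.span ℝ (hankelCol s d '' {j : ℕ | j < i})} =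
      Set.Icc T.card d := by
    ext i
    rw [Set.mem_ofPred_eq, Set.mem_Icc, and_comm]
    refine and_congr_left fun hid => ?_
    rw [hankelCol_mem_span_iff]
    constructor
    · rintro ⟨g, hg, hker⟩
      set f := X ^ i - g
      have hf : f.natDegree = i := by
        have : f.degree = i := by
          rw [degree_sub_eq_left_of_degree_lt (by rwa [degree_X_pow]), degree_X_pow]
        exact natDegree_eq_of_degree_eq_some this
      have hf0 : f ≠ 0 := (monic_X_pow_sub hg).ne_zero
      have h1 : riesz s (f * f) = 0 := riesz_mul_eq_zero (D := i) (fun j hj => by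
        have := congrFun hker ⟨j, by omega⟩
        rwa [hankelColMap_apply] at this) hf.le
      rw [hriesz _ (natDegree_mul_le.trans (by omega))] at h1
      have h2 := eval_eq_zero_of_sum_eq_zero hw h1
      by_contra hlt
      refine hf0 (eq_zero_of_degree_lt_of_eval_finset_eq_zero T ?_ h2)
      rw [degree_eq_natDegree hf0, hf]
      exact_mod_cast not_le.mp hlt
    · intro hTi
      -- The power of `X` only pads the nodal polynomial to degree exactly `i`.
      set q : ℝ[X] := Lagrange.nodal T id * X ^ (i - T.card) with hq
      have hqm : q.Monic := Lagrange.nodal_monic.mul (monic_X_pow _)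
      have hqd : q.natDegree = i := by
        rw [hq, Lagrange.nodal_monic.natDegree_mul (monic_X_pow _), natDegree_X_pow,
          Lagrange.natDegree_nodal]
        omega
      refine ⟨X ^ i - q, ?_, ?_⟩
      · have h1 := degree_sub_lt_left (p := X ^ i) (q := q)
          (by rw [degree_X_pow, degree_eq_natDegree hqm.ne_zero, hqd]) (monic_X_pow i).ne_zero
          (by rw [(monic_X_pow i).leadingCoeff, hqm.leadingCoeff])
        rwa [degree_X_pow] at h1
      · rw [sub_sub_cancel]
        ext l
        rw [hankelColMap_apply, hriesz _ (natDegree_mul_le.trans (by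
          rw [hqd, natDegree_X_pow]; omega))]
        refine Finset.sum_eq_zero fun t ht => ?_
        rw [eval_mul, hq, eval_mul]
        have : eval t (Lagrange.nodal T (id : ℝ → ℝ)) = 0 :=
          Lagrange.eval_nodal_at_node (v := id) ht
        rw [this, zero_mul, zero_mul, mul_zero]
  rw [hset, csInf_Icc hT]

end CuspTMP
end

noncomputable section

namespace CuspTMP

open Polynomial MeasureTheory

/-! ### The univariate moment sequence -/

/-- The moments of the parameter `t` of the cusp `(t ^ 2, t ^ 3)`; the moment of order `1` is not
determined by `β`, its value is the argument `c`. -/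
def gam (β : ℕ → ℕ → ℝ) (c : ℝ) : ℕ → ℝ
  | 0 => β 0 0
  | 1 => c
  | n + 2 => conc β n

lemma gam_zero (β : ℕ → ℕ → ℝ) (c : ℝ) : gam β c 0 = β 0 0 := rfl

lemma gam_one (β : ℕ → ℕ → ℝ) (c : ℝ) : gam β c 1 = c := rfl

lemma gam_add_two (β : ℕ → ℕ → ℝ) (c : ℝ) (n : ℕ) : gam β c (n + 2) = conc β n := rfl

lemma gam_congr (β : ℕ → ℕ → ℝ) (c c' : ℝ) {n : ℕ} (hn : n ≠ 1) : gam β c n = gam β c' n := by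
  match n, hn with
  | 0, _ => rfl
  | n + 2, _ => rfl

lemma conc_three_mul (β : ℕ → ℕ → ℝ) (i : ℕ) : conc β (3 * i) = β 1 i := by
  have h1 : 3 * i / 3 = i := by omega
  have h2 : 3 * i % 3 = 0 := by omega
  simp [conc, h1, h2, u]

lemma conc_three_mul_add_one (β : ℕ → ℕ → ℝ) (i : ℕ) : conc β (3 * i + 1) = β 0 (i + 1) := by
  have h1 : (3 * i + 1) / 3 = i := by omega
  have h2 : (3 * i + 1) % 3 = 1 := by omega
  simp [conc, h1, h2, u]

lemma conc_three_mul_add_two (β : ℕ → ℕ → ℝ) (i : ℕ) : conc β (3 * i + 2) = β 2 i := by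
  have h1 : (3 * i + 2) / 3 = i := by omega
  have h2 : (3 * i + 2) % 3 = 2 := by omega
  simp [conc, h1, h2, u]

lemma gam_eq_of_le_two (β : ℕ → ℕ → ℝ) (c : ℝ) {i j : ℕ} (hi : i ≤ 2) :
    gam β c (2 * i + 3 * j) = β i j := by
  interval_cases i
  · cases j with
    | zero => rfl
    | succ j =>
      rw [show 2 * 0 + 3 * (j + 1) = (3 * j + 1) + 2 by ring, gam_add_two, conc_three_mul_add_one]
  · rw [show 2 * 1 + 3 * j = 3 * j + 2 by ring, gam_add_two, conc_three_mul]
  · rw [show 2 * 2 + 3 * j = (3 * j + 2) + 2 by ring, gam_add_two, conc_three_mul_add_two]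

/-- `1` is the only gap of the semigroup generated by `2` and `3`. The bound `i ≤ 2` selects the
representative stored in `conc`. -/
lemma exists_exponents {n k : ℕ} (hn : n ≤ 3 * k) (hn1 : n ≠ 1) :
    ∃ i j, i + j ≤ k ∧ i ≤ 2 ∧ 2 * i + 3 * j = n := by
  obtain h | h | h : n % 3 = 0 ∨ n % 3 = 1 ∨ n % 3 = 2 := by omega
  · exact ⟨0, n / 3, by omega, by omega, by omega⟩
  · exact ⟨2, n / 3 - 1, by omega, by omega, by omega⟩
  · exact ⟨1, n / 3, by omega, by omega, by omega⟩

/-- The value of `c` is arbitrary: sums of two exponents are at least `2`. The same happens for the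
next matrices; in `tildeA` the exponents `0, 2, 3, …` never add up to `1`. -/
lemma ATilde_eq_gram (β : ℕ → ℕ → ℝ) (k : ℕ) (c : ℝ) :
    ATilde β k = gram (gam β c) fun a : Fin (3 * k - 1 + 1) => (a : ℕ) + 1 := by
  ext a b
  simp only [ATilde, hankel, gram, Matrix.of_apply]
  rw [show (a : ℕ) + 1 + (b + 1) = (a + b) + 2 by ring, gam_add_two]

lemma AHat_eq_gram (β : ℕ → ℕ → ℝ) (k : ℕ) (c : ℝ) :
    AHat β k = gram (gam β c) fun a : Fin (3 * k - 2 + 1) => (a : ℕ) + 1 := by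
  ext a b
  simp only [AHat, hankel, gram, Matrix.of_apply]
  rw [show (a : ℕ) + 1 + (b + 1) = (a + b) + 2 by ring, gam_add_two]

lemma ABreve_eq_gram (β : ℕ → ℕ → ℝ) (k : ℕ) (c : ℝ) :
    ABreve β k = gram (gam β c) fun a : Fin (3 * k - 2 + 1) => (a : ℕ) + 2 := by
  ext a b
  simp only [ABreve, hankel, gram, Matrix.of_apply]
  rw [show (a : ℕ) + 2 + (b + 2) = (a + b + 2) + 2 by ring, gam_add_two]

lemma tildeA_eq_gram (β : ℕ → ℕ → ℝ) (k : ℕ) (c : ℝ) :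
    tildeA β k = gram (gam β c)
      (Sum.elim (fun _ => 0) fun a : Fin (3 * k - 3 + 1) => (a : ℕ) + 2) := by
  ext a b
  rcases a with a | a <;> rcases b with b | b
  · simp [tildeA, gram, gam_zero]
  · simp [tildeA, gram, vVec, gam_add_two]
  · simp [tildeA, gram, vVec, gam_add_two]
  · simp only [tildeA, gram, ABar, hankel, Matrix.fromBlocks_apply₂₂, Matrix.of_apply,
      Sum.elim_inr]
    rw [show (a : ℕ) + 2 + (b + 2) = (a + b + 2) + 2 by ring, gam_add_two]

/-- The moments `β` are those of the sequence `gam β c` on the cusp `(t ^ 2, t ^ 3)`. -/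
def FactorsThroughCusp (β : ℕ → ℕ → ℝ) (k : ℕ) : Prop :=
  ∀ c i j, i + j ≤ 2 * k → β i j = gam β c (2 * i + 3 * j)

/-- The degree of `x ^ i y ^ j` in the parameter of the cusp. -/
def cuspExp {k : ℕ} (m : MonIdx k) : ℕ := 2 * m.1.1 + 3 * m.1.2

lemma momentMatrix_eq_gram {β : ℕ → ℕ → ℝ} {k : ℕ} (hβ : FactorsThroughCusp β k) (c : ℝ) :
    momentMatrix β k = gram (gam β c) (cuspExp (k := k)) := by
  ext a b
  simp only [momentMatrix, gram, Matrix.of_apply, cuspExp]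
  have ha := a.2
  have hb := b.2
  rw [hβ c _ _ (by omega)]
  congr 1
  ring

lemma cuspExp_le {k : ℕ} (m : MonIdx k) : cuspExp m ≤ 3 * k := by
  have := m.2
  unfold cuspExp
  omega

/-- A choice of a monomial of degree at most `k` for every exponent `0, 2, 3, …, 3k`. -/
lemma exists_monIdx {k n : ℕ} (hn : n ≤ 3 * k) (hn1 : n ≠ 1) : ∃ m : MonIdx k, cuspExp m = n := by
  obtain ⟨i, j, hij, -, rfl⟩ := exists_exponents hn hn1
  exact ⟨⟨(⟨i, by omega⟩, ⟨j, by omega⟩), hij⟩, rfl⟩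

/-- `cuspExp` is not injective in general, so each coefficient is placed on one chosen monomial with
the right exponent. -/
lemma exists_expPoly_cuspExp {k : ℕ} {f : ℝ[X]} (hf : f.natDegree ≤ 3 * k) (hf1 : f.coeff 1 = 0) :
    ∃ v, expPoly (cuspExp (k := k)) v = f := by
  classical
  have h : ∀ n ∈ f.support, ∃ m : MonIdx k, cuspExp m = n := fun n hn =>
    exists_monIdx ((le_natDegree_of_mem_supp n hn).trans hf) (by
      rintro rfl; exact mem_support_iff.mp hn hf1)
  have : Nonempty (MonIdx k) := ⟨⟨(0, 0), by simp⟩⟩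
  choose! e he using h
  refine ⟨fun m => ∑ n ∈ f.support, if e n = m then f.coeff n else 0, ?_⟩
  simp only [expPoly, map_sum, Finset.sum_mul]
  rw [Finset.sum_comm]
  conv_rhs => rw [f.as_sum_support_C_mul_X_pow]
  refine Finset.sum_congr rfl fun n hn => ?_
  rw [Finset.sum_eq_single (e n)]
  · rw [if_pos rfl, he n hn]
  · intro m _ hm
    rw [if_neg hm.symm]; simp
  · simp

lemma riesz_mul_self_nonneg_of_momentMatrix {β : ℕ → ℕ → ℝ} {k : ℕ}
    (hβ : FactorsThroughCusp β k) (hM : (momentMatrix β k).PosSemidef) (c : ℝ) {f : ℝ[X]}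
    (hf : f.natDegree ≤ 3 * k) (hf1 : f.coeff 1 = 0) : 0 ≤ riesz (gam β c) (f * f) := by
  obtain ⟨v, rfl⟩ := exists_expPoly_cuspExp hf hf1
  rw [← dotProduct_gram_mulVec, ← momentMatrix_eq_gram hβ]
  exact hM.dotProduct_mulVec_nonneg v

/-! ### Column relations of the moment matrix -/

section ColumnRelations

open MvPolynomial

/-- The exponent vector of `x ^ a y ^ b`. -/
def biexp (a b : ℕ) : Fin 2 →₀ ℕ := Finsupp.single 0 a + Finsupp.single 1 b

lemma biexp_inj {a b a' b' : ℕ} : biexp a b = biexp a' b' ↔ a = a' ∧ b = b' := by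
  constructor
  · intro h
    have h0 := DFunLike.congr_fun h 0
    have h1 := DFunLike.congr_fun h 1
    simp [biexp] at h0 h1
    exact ⟨h0, h1⟩
  · rintro ⟨rfl, rfl⟩; rfl

lemma colVec_monomial_sub (β : ℕ → ℕ → ℝ) {k a b a' b' : ℕ} (h : a + b ≤ k) (h' : a' + b' ≤ k)
    (r : MonIdx k) :
    colVec β k (MvPolynomial.monomial (biexp a b) 1 - MvPolynomial.monomial (biexp a' b') 1) r =
      β (r.1.1 + a) (r.1.2 + b) - β (r.1.1 + a') (r.1.2 + b') := by
  have hs : ∀ {a b : ℕ} (h : a + b ≤ k), coeffVec k (MvPolynomial.monomial (biexp a b) 1) =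
      Pi.single (⟨(⟨a, by omega⟩, ⟨b, by omega⟩), h⟩ : MonIdx k) 1 := by
    intro a b h
    ext c
    rw [coeffVec, MvPolynomial.coeff_monomial, ← biexp, Pi.single_apply]
    refine if_congr ?_ rfl rfl
    rw [biexp_inj, Subtype.ext_iff, Prod.ext_iff, Fin.ext_iff, Fin.ext_iff]
    exact and_congr eq_comm eq_comm
  have hsub : ∀ p q : MvPolynomial (Fin 2) ℝ, coeffVec k (p - q) = coeffVec k p - coeffVec k q := by
    intro p q
    ext c
    simp [coeffVec]
  rw [colVec, hsub, hs h, hs h', Matrix.mulVec_sub, Pi.sub_apply, Matrix.mulVec_single_one,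
    Matrix.mulVec_single_one]
  rfl

lemma cuspPoly_mul_monomial (a b : ℕ) : cuspPoly * MvPolynomial.monomial (biexp a b) 1 =
    MvPolynomial.monomial (biexp a (b + 2)) 1 - MvPolynomial.monomial (biexp (a + 3) b) 1 := by
  have h : ∀ a b : ℕ, (MvPolynomial.monomial (biexp a b) 1 : MvPolynomial (Fin 2) ℝ) =
      MvPolynomial.X 0 ^ a * MvPolynomial.X 1 ^ b := by
    intro a b
    rw [biexp, MvPolynomial.X_pow_eq_monomial, MvPolynomial.X_pow_eq_monomial,
      MvPolynomial.monomial_mul, one_mul]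
  rw [h, h, h, cuspPoly]
  ring

lemma totalDegree_monomial_biexp (a b : ℕ) :
    (MvPolynomial.monomial (biexp a b) (1 : ℝ)).totalDegree ≤ a + b := by
  refine (MvPolynomial.totalDegree_monomial_le _ _).trans (le_of_eq ?_)
  rw [biexp, Finsupp.sum_fintype _ _ (fun _ => rfl)]
  simp

lemma cuspPoly_eq : cuspPoly =
    MvPolynomial.monomial (biexp 0 2) 1 - MvPolynomial.monomial (biexp 3 0) 1 := by
  rw [← cuspPoly_mul_monomial 0 0, biexp]
  simp

lemma colVec_cuspPoly_eq_zero {β : ℕ → ℕ → ℝ} {k : ℕ} (hk : 3 ≤ k)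
    (hβ : FactorsThroughCusp β k) : colVec β k cuspPoly = 0 := by
  ext r
  have hr := r.2
  rw [cuspPoly_eq, colVec_monomial_sub β (by omega) (by omega), hβ 0 _ _ (by omega),
    hβ 0 _ _ (by omega), Pi.zero_apply, sub_eq_zero]
  congr 1
  ring

/-- Replacing `x ^ 3` by `y ^ 2` preserves the exponent of `t` and lowers the degree, so repeated
use reaches `i ≤ 2`. -/
lemma factorsThroughCusp_of_relations {β : ℕ → ℕ → ℝ} {k : ℕ}
    (h : ∀ i j, i + 3 + j ≤ 2 * k → β (i + 3) j = β i (j + 2)) : FactorsThroughCusp β k := by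
  intro c i
  induction i using Nat.strong_induction_on with
  | _ i ih =>
    intro j hij
    by_cases hi : i ≤ 2
    · rw [gam_eq_of_le_two β c hi]
    · obtain ⟨i, rfl⟩ : ∃ i', i = i' + 3 := ⟨i - 3, by omega⟩
      rw [h i j hij, ih i (by omega) (j + 2) (by omega)]
      congr 1
      ring

lemma factorsThroughCusp_of_condition {β : ℕ → ℕ → ℝ} {k : ℕ} (hrg : RecursivelyGenerated β k)
    (h : (3 ≤ k ∧ colVec β k cuspPoly = 0) ∨
      (k = 2 ∧ β 0 2 = β 3 0 ∧ β 1 2 = β 4 0 ∧ β 0 3 = β 3 1) ∨ k = 1) :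
    FactorsThroughCusp β k := by
  refine factorsThroughCusp_of_relations ?_
  rcases h with ⟨hk, hcol⟩ | ⟨rfl, h1, h2, h3⟩ | rfl
  · intro i j hij
    -- split `(i, j)` as the sum of a row index of degree `≤ k` and one of degree `≤ k - 3`
    obtain ⟨a, b, a', b', ha, hb, hab, hab'⟩ : ∃ a b a' b', a + a' = i ∧ b + b' = j ∧
        a + b ≤ k ∧ a' + b' + 3 ≤ k := by
      by_cases h : i ≤ k
      · by_cases h' : i + j ≤ k
        · exact ⟨i, j, 0, 0, by omega⟩
        · exact ⟨i, k - i, 0, j - (k - i), by omega⟩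
      · exact ⟨k, 0, i - k, j, by omega⟩
    have hd := totalDegree_monomial_biexp a' b'
    have hc : cuspPoly.totalDegree ≤ k := by
      rw [cuspPoly_eq]
      refine (MvPolynomial.totalDegree_sub _ _).trans (max_le ?_ ?_) <;>
      exact (totalDegree_monomial_biexp _ _).trans (by omega)
    have h1 := hrg cuspPoly (MvPolynomial.monomial (biexp a' b') 1) hc
      (hd.trans (by omega)) (by
        rw [cuspPoly_mul_monomial]
        refine (MvPolynomial.totalDegree_sub _ _).trans (max_le ?_ ?_) <;>
        exact (totalDegree_monomial_biexp _ _).trans (by omega)) hcol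
    have h2 := congrFun h1 ⟨(⟨a, by omega⟩, ⟨b, by omega⟩), hab⟩
    rw [cuspPoly_mul_monomial, colVec_monomial_sub β (by omega) (by omega), Pi.zero_apply,
      sub_eq_zero] at h2
    simp only at h2
    rw [show a + (a' + 3) = i + 3 by omega, show b + b' = j by omega, show a + a' = i by omega,
      show b + (b' + 2) = j + 2 by omega] at h2
    exact h2.symm
  -- For `k = 2` the three assumed equations are all the relations that fit in degree `4`.
  · intro i j hij
    obtain ⟨rfl, rfl⟩ | ⟨rfl, rfl⟩ | ⟨rfl, rfl⟩ :
      (i = 0 ∧ j = 0) ∨ (i = 1 ∧ j = 0) ∨ (i = 0 ∧ j = 1) := by omega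
    · exact h1.symm
    · exact h2.symm
    · exact h3.symm
  · intro i j hij
    omega

lemma condition_of_factorsThroughCusp {β : ℕ → ℕ → ℝ} {k : ℕ} (hk : 1 ≤ k)
    (hβ : FactorsThroughCusp β k) : (3 ≤ k ∧ colVec β k cuspPoly = 0) ∨
      (k = 2 ∧ β 0 2 = β 3 0 ∧ β 1 2 = β 4 0 ∧ β 0 3 = β 3 1) ∨ k = 1 := by
  obtain h | rfl | rfl : 3 ≤ k ∨ k = 2 ∨ k = 1 := by omega
  · exact Or.inl ⟨h, colVec_cuspPoly_eq_zero h hβ⟩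
  · refine Or.inr (Or.inl ⟨rfl, ?_, ?_, ?_⟩) <;>
    rw [hβ 0 _ _ (by norm_num), hβ 0 _ _ (by norm_num)]
  · exact Or.inr (Or.inr rfl)

end ColumnRelations

end CuspTMP
end

noncomputable section

namespace CuspTMP

open Polynomial MeasureTheory

/-! ### Measures on the cusp -/

/-- The inverse of the parametrization `t ↦ (t ^ 2, t ^ 3)` of the cusp. -/
def cuspParam (z : ℝ × ℝ) : ℝ := z.2 / z.1

lemma measurable_cuspParam : Measurable cuspParam := measurable_snd.div measurable_fst

/-- At the origin the convention `0 / 0 = 0` gives the correct parameter. -/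
lemma cuspParam_pow_two {z : ℝ × ℝ} (hz : z ∈ cusp) : cuspParam z ^ 2 = z.1 := by
  have hz' : z.2 ^ 2 = z.1 ^ 3 := hz
  by_cases h : z.1 = 0
  · simp [cuspParam, h]
  · rw [cuspParam, div_pow, hz']
    field_simp

lemma cuspParam_pow_three {z : ℝ × ℝ} (hz : z ∈ cusp) : cuspParam z ^ 3 = z.2 := by
  have hz' : z.2 ^ 2 = z.1 ^ 3 := hz
  by_cases h : z.1 = 0
  · have h2 : z.2 = 0 := by
      rw [h] at hz'
      exact pow_eq_zero_iff two_ne_zero |>.mp (by rw [hz']; norm_num)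
    simp [cuspParam, h, h2]
  · rw [cuspParam, div_pow, ← hz', pow_succ, mul_div_assoc]
    have h2 : z.2 ≠ 0 := fun h2 => h (by
      rw [h2] at hz'
      exact pow_eq_zero_iff three_ne_zero |>.mp (by rw [← hz']; norm_num))
    field_simp

lemma cuspParam_mk (t : ℝ) : cuspParam (t ^ 2, t ^ 3) = t := by
  by_cases h : t = 0
  · simp [cuspParam, h]
  · simp only [cuspParam]
    field_simp

lemma cuspParam_pow {z : ℝ × ℝ} (hz : z ∈ cusp) (i j : ℕ) :
    cuspParam z ^ (2 * i + 3 * j) = z.1 ^ i * z.2 ^ j := by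
  rw [pow_add, pow_mul, pow_mul, cuspParam_pow_two hz, cuspParam_pow_three hz]

variable {β : ℕ → ℕ → ℝ} {k : ℕ} {μ : Measure (ℝ × ℝ)}

lemma IsRepMeasure.ae_mem (h : IsRepMeasure β k cusp μ) : ∀ᵐ z ∂μ, z ∈ cusp := h.1

lemma IsRepMeasure.integral_pow (h : IsRepMeasure β k cusp μ) {i j : ℕ} (hij : i + j ≤ 2 * k) :
    Integrable (fun z => cuspParam z ^ (2 * i + 3 * j)) μ ∧
      ∫ z, cuspParam z ^ (2 * i + 3 * j) ∂μ = β i j := by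
  have hae : (fun z : ℝ × ℝ => z.1 ^ i * z.2 ^ j) =ᵐ[μ]
      fun z => cuspParam z ^ (2 * i + 3 * j) := by
    filter_upwards [h.ae_mem] with z hz
    exact (cuspParam_pow hz i j).symm
  obtain ⟨h1, h2⟩ := h.2 i j hij
  exact ⟨h1.congr hae, by rw [← h2]; exact integral_congr_ae hae.symm⟩

lemma two_mul_add_three_mul_ne_one (i j : ℕ) : 2 * i + 3 * j ≠ 1 := by omega

/-- The missing moment of order `1` exists because `|t| ≤ 1 + t ^ 2`; its value is the `c` to use.
-/
lemma IsRepMeasure.exists_gam (hk : 1 ≤ k) (h : IsRepMeasure β k cusp μ) :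
    ∃ c, ∀ n ≤ 6 * k, Integrable (fun z => cuspParam z ^ n) μ ∧
      gam β c n = ∫ z, cuspParam z ^ n ∂μ := by
  refine ⟨∫ z, cuspParam z ^ 1 ∂μ, fun n hn => ?_⟩
  have h0 : ∀ n ≤ 6 * k, n ≠ 1 → ∃ i j, i + j ≤ 2 * k ∧ i ≤ 2 ∧ 2 * i + 3 * j = n :=
    fun n hn hn1 => exists_exponents (k := 2 * k) (by omega) hn1
  by_cases hn1 : n = 1
  · subst hn1
    refine ⟨?_, rfl⟩
    obtain ⟨h1, -⟩ := h.integral_pow (i := 0) (j := 0) (by omega)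
    obtain ⟨h2, -⟩ := h.integral_pow (i := 1) (j := 0) (by omega)
    refine (h1.add h2).mono' (measurable_cuspParam.pow_const 1).aestronglyMeasurable
      (.of_forall fun z => ?_)
    simp only [Pi.add_apply, mul_zero, mul_one, add_zero, pow_zero, pow_one, Real.norm_eq_abs]
    rw [← sq_abs (cuspParam z)]
    nlinarith [sq_nonneg (|cuspParam z| - 1), sq_nonneg (|cuspParam z|)]
  · obtain ⟨i, j, hij, hi, rfl⟩ := h0 n hn hn1
    obtain ⟨h1, h2⟩ := h.integral_pow hij
    exact ⟨h1, by rw [h2, gam_eq_of_le_two β _ hi]⟩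

lemma IsRepMeasure.factorsThroughCusp (hk : 1 ≤ k) (h : IsRepMeasure β k cusp μ) :
    FactorsThroughCusp β k := by
  intro c i j hij
  obtain ⟨c', hc'⟩ := h.exists_gam hk
  rw [gam_congr β c c' (two_mul_add_three_mul_ne_one i j), (hc' _ (by omega)).2,
    (h.integral_pow hij).2]

lemma riesz_eq_integral {γ : ℕ → ℝ} {N : ℕ}
    (hγ : ∀ n ≤ N, Integrable (fun z => cuspParam z ^ n) μ ∧ γ n = ∫ z, cuspParam z ^ n ∂μ)
    {f : ℝ[X]} (hf : f.natDegree ≤ N) :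
    Integrable (fun z => f.eval (cuspParam z)) μ ∧
      riesz γ f = ∫ z, f.eval (cuspParam z) ∂μ := by
  have h1 : ∀ n ∈ f.support, Integrable (fun z => f.coeff n * cuspParam z ^ n) μ :=
    fun n hn => (hγ n ((le_natDegree_of_mem_supp n hn).trans hf)).1.const_mul _
  simp_rw [eval_eq_sum, sum_def]
  refine ⟨integrable_finsetSum _ h1, ?_⟩
  rw [integral_finsetSum _ h1, riesz_eq_sum_support]
  refine Finset.sum_congr rfl fun n hn => ?_
  rw [integral_const_mul, (hγ n ((le_natDegree_of_mem_supp n hn).trans hf)).2, mul_comm]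

lemma riesz_mul_self_eq_integral {γ : ℕ → ℝ} {N : ℕ}
    (hγ : ∀ n ≤ 2 * N, Integrable (fun z => cuspParam z ^ n) μ ∧ γ n = ∫ z, cuspParam z ^ n ∂μ)
    {f : ℝ[X]} (hf : f.natDegree ≤ N) :
    0 ≤ riesz γ (f * f) ∧
      (riesz γ (f * f) = 0 ↔ ∀ᵐ z ∂μ, f.eval (cuspParam z) = 0) := by
  obtain ⟨h1, h2⟩ := riesz_eq_integral hγ (f := f * f) (natDegree_mul_le.trans (by omega))
  have h3 : 0 ≤ fun z => (f * f).eval (cuspParam z) := fun z => by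
    simpa using mul_self_nonneg _
  rw [h2]
  refine ⟨integral_nonneg h3, ?_⟩
  rw [integral_eq_zero_iff_of_nonneg h3 h1]
  refine Filter.eventually_congr (.of_forall fun z => ?_)
  simp

/-- The atomic measure with masses `w t` at the points `(t ^ 2, t ^ 3)`, `t ∈ T`,
represents `β`. -/
def IsAtomicRep (β : ℕ → ℕ → ℝ) (k : ℕ) (T : Finset ℝ) (w : ℝ → ℝ) : Prop :=
  (∀ t ∈ T, 0 < w t) ∧ ∀ i j, i + j ≤ 2 * k → β i j = ∑ t ∈ T, w t * t ^ (2 * i + 3 * j)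

lemma natDegree_le_of_support {f : ℝ[X]} {N : ℕ} (h : ∀ n ∈ f.support, n ≤ N) :
    f.natDegree ≤ N := by
  by_cases hf : f = 0
  · simp [hf]
  · exact h _ (natDegree_mem_support_of_nonzero hf)

lemma isAtomicRep_of_gam {T : Finset ℝ} {w : ℝ → ℝ} {c : ℝ} (hβ : FactorsThroughCusp β k)
    (hw : ∀ t ∈ T, 0 < w t) (h : ∀ n ≤ 6 * k, gam β c n = ∑ t ∈ T, w t * t ^ n) :
    IsAtomicRep β k T w :=
  ⟨hw, fun i j hij => by rw [hβ c i j hij, h _ (by omega)]⟩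

lemma IsRepMeasure.ATilde_posSemidef (hk : 1 ≤ k) (h : IsRepMeasure β k cusp μ) :
    (ATilde β k).PosSemidef := by
  obtain ⟨c, hc⟩ := h.exists_gam hk
  rw [ATilde_eq_gram β k c]
  refine gram_posSemidef fun f hf => ?_
  refine (riesz_mul_self_eq_integral (N := 3 * k) (fun n hn => hc n (by omega)) ?_).1
  refine natDegree_le_of_support fun n hn => ?_
  obtain ⟨a, rfl⟩ := hf n hn
  omega

lemma add_injective (N e : ℕ) : Function.Injective fun a : Fin N => (a : ℕ) + e :=
  fun a b h => by simpa [Fin.ext_iff] using h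

lemma tildeA_exp_injective (N : ℕ) : Function.Injective
    (Sum.elim (fun _ => 0) fun a : Fin N => (a : ℕ) + 2 : Unit ⊕ Fin N → ℕ) := by
  rintro (a | a) (b | b) h
  · rfl
  · simp at h
  · simp at h
  · simpa [Fin.ext_iff] using h

lemma IsRepMeasure.tildeA_posDef (hk : 1 ≤ k) (h : IsRepMeasure β k cusp μ)
    (hA : (ATilde β k).PosDef) : (tildeA β k).PosDef := by
  obtain ⟨c, hc⟩ := h.exists_gam hk
  have hc' : ∀ n ≤ 2 * (3 * k), Integrable (fun z => cuspParam z ^ n) μ ∧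
      gam β c n = ∫ z, cuspParam z ^ n ∂μ := fun n hn => hc n (by omega)
  rw [ATilde_eq_gram β k c] at hA
  rw [tildeA_eq_gram β k c]
  refine gram_posDef (tildeA_exp_injective _) fun f hf hf0 => ?_
  have hfd : ∀ n ∈ f.support, n < 3 * k := fun n hn => by
    obtain ⟨a | a, rfl⟩ := hf n hn
    · simp; omega
    · simp only [Sum.elim_inr]; omega
  have h1 := riesz_mul_self_eq_integral hc' (natDegree_le_of_support fun n hn => (hfd n hn).le)
  refine h1.1.lt_of_ne' fun h2 => ?_
  -- Multiplication by `X` moves `f` into the span of `X, …, X ^ (3k)`, where `ATilde` is definite,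
  -- while keeping it zero a.e.
  have hsup : ∀ n ∈ (X ^ 1 * f).support, ∃ a : Fin (3 * k - 1 + 1), (a : ℕ) + 1 = n := by
    intro n hn
    obtain ⟨m, hm, rfl⟩ := mem_support_X_pow_mul hn
    have := hfd m hm
    exact ⟨⟨m, by omega⟩, rfl⟩
  have h3 := riesz_mul_self_pos (add_injective _ _) hA hsup
    (mul_ne_zero (pow_ne_zero _ X_ne_zero) hf0)
  refine h3.ne' ((riesz_mul_self_eq_integral hc' (natDegree_le_of_support fun n hn => ?_)).2.mpr ?_)
  · obtain ⟨a, rfl⟩ := hsup n hn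
    omega
  · filter_upwards [h1.2.mp h2] with z hz
    rw [eval_mul, hz, mul_zero]

/-- A measure whose parameter lies almost surely in a finite set has finitely atomic moments. -/
lemma integral_pow_eq_sum [IsFiniteMeasure μ] {R : Finset ℝ} (hR : ∀ᵐ z ∂μ, cuspParam z ∈ R)
    (n : ℕ) :
    ∫ z, cuspParam z ^ n ∂μ = ∑ t ∈ R, μ.real (cuspParam ⁻¹' {t}) * t ^ n := by
  have hm : ∀ t : ℝ, MeasurableSet (cuspParam ⁻¹' {t}) := fun t =>
    measurable_cuspParam (measurableSet_singleton t)
  have hae : (fun z => cuspParam z ^ n) =ᵐ[μ]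
      fun z => ∑ t ∈ R, (cuspParam ⁻¹' {t}).indicator (fun _ => t ^ n) z := by
    filter_upwards [hR] with z hz
    rw [Finset.sum_eq_single (cuspParam z)]
    · simp
    · intro t _ ht
      exact Set.indicator_of_notMem (fun h : cuspParam z = t => ht h.symm) _
    · exact fun h => absurd hz h
  rw [integral_congr_ae hae, integral_finsetSum]
  · refine Finset.sum_congr rfl fun t _ => ?_
    rw [integral_indicator_const _ (hm t), smul_eq_mul]
  · exact fun t _ => (integrable_const _).indicator (hm t)

lemma IsRepMeasure.exists_isAtomicRep (hk : 1 ≤ k) (h : IsRepMeasure β k cusp μ)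
    (hA : ¬ (ATilde β k).PosDef) :
    ∃ T w, IsAtomicRep β k T w ∧ (T.erase 0).card < 3 * k := by
  obtain ⟨c, hc⟩ := h.exists_gam hk
  have hc' : ∀ n ≤ 2 * (3 * k), Integrable (fun z => cuspParam z ^ n) μ ∧
      gam β c n = ∫ z, cuspParam z ^ n ∂μ := fun n hn => hc n (by omega)
  rw [ATilde_eq_gram β k c] at hA
  obtain ⟨f, hf, hf0, hfz⟩ : ∃ f : ℝ[X],
      (∀ n ∈ f.support, ∃ a : Fin (3 * k - 1 + 1), (a : ℕ) + 1 = n) ∧ f ≠ 0 ∧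
      riesz (gam β c) (f * f) ≤ 0 := by
    by_contra! hcon
    exact hA (gram_posDef (add_injective _ _) hcon)
  have hfd : f.natDegree ≤ 3 * k := natDegree_le_of_support fun n hn => by
    obtain ⟨a, rfl⟩ := hf n hn
    omega
  have h1 := riesz_mul_self_eq_integral hc' hfd
  have h2 := h1.2.mp (le_antisymm hfz h1.1)
  -- Of the at most `3k` roots of `f`, one is `0`; this makes the bound on nonzero atoms strict.
  have hroot0 : f.IsRoot 0 := by
    rw [IsRoot, ← coeff_zero_eq_eval_zero]
    by_contra h0
    obtain ⟨a, ha⟩ := hf 0 (mem_support_iff.mpr h0)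
    omega
  have hfin : IsFiniteMeasure μ := by
    have := (hc 0 (by omega)).1
    simp only [pow_zero] at this
    exact (integrable_const_iff_isFiniteMeasure (one_ne_zero : (1 : ℝ) ≠ 0)).mp this
  have hR : ∀ᵐ z ∂μ, cuspParam z ∈ f.roots.toFinset := by
    filter_upwards [h2] with z hz
    rw [Multiset.mem_toFinset, mem_roots hf0]
    exact hz
  set R := f.roots.toFinset with hRdef
  have hRcard : (R.erase 0).card < 3 * k := by
    rw [Finset.card_erase_of_mem (by rw [hRdef, Multiset.mem_toFinset, mem_roots hf0]; exact hroot0)]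
    have h3 := (Multiset.toFinset_card_le f.roots).trans (card_roots' f)
    rw [← hRdef] at h3
    omega
  refine ⟨{t ∈ R | 0 < μ.real (cuspParam ⁻¹' {t})}, fun t => μ.real (cuspParam ⁻¹' {t}),
    isAtomicRep_of_gam (c := c) (h.factorsThroughCusp hk) (fun t ht => (Finset.mem_filter.mp ht).2)
      fun n hn => ?_,
    (Finset.card_le_card (Finset.erase_subset_erase 0 (Finset.filter_subset _ _))).trans_lt hRcard⟩
  rw [(hc n hn).2, integral_pow_eq_sum hR, Finset.sum_filter]
  refine Finset.sum_congr rfl fun t _ => ?_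
  split_ifs with h4
  · rfl
  · rw [le_antisymm (not_lt.mp h4) measureReal_nonneg, zero_mul]

/-! ### Atomic measures -/

lemma integral_atomic (s : Finset (ℝ × ℝ)) {w : ℝ × ℝ → ℝ} (hw : ∀ z ∈ s, 0 < w z)
    (f : ℝ × ℝ → ℝ) :
    Integrable f (∑ z ∈ s, ENNReal.ofReal (w z) • Measure.dirac z) ∧
      ∫ z, f z ∂(∑ z ∈ s, ENNReal.ofReal (w z) • Measure.dirac z) = ∑ z ∈ s, w z * f z := by
  have h1 : ∀ z ∈ s, Integrable f (ENNReal.ofReal (w z) • Measure.dirac z) := fun z _ =>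
    (integrable_dirac (by simp)).smul_measure ENNReal.ofReal_ne_top
  refine ⟨integrable_finsetSum_measure.mpr h1, ?_⟩
  rw [integral_finsetSum_measure h1]
  refine Finset.sum_congr rfl fun z hz => ?_
  rw [integral_smul_measure, integral_dirac, ENNReal.toReal_ofReal (hw z hz).le, smul_eq_mul]

lemma IsAtomicRep.card_mem_atomCounts {T : Finset ℝ} {w : ℝ → ℝ} (h : IsAtomicRep β k T w) :
    T.card ∈ atomCounts β k := by
  classical
  have hinj : Function.Injective fun t : ℝ => (t ^ 2, t ^ 3) := fun s t hst => by
    rw [← cuspParam_mk s, ← cuspParam_mk t]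
    exact congrArg cuspParam hst
  set s := T.image fun t : ℝ => (t ^ 2, t ^ 3) with hs
  have hpos : ∀ z ∈ s, 0 < w (cuspParam z) := fun z hz => by
    obtain ⟨t, ht, rfl⟩ := Finset.mem_image.mp hz
    rw [cuspParam_mk]
    exact h.1 t ht
  refine ⟨∑ z ∈ s, ENNReal.ofReal (w (cuspParam z)) • Measure.dirac z, ⟨?_, fun i j hij => ?_⟩,
    s, fun z => w (cuspParam z), Finset.card_image_of_injective _ hinj, hpos, rfl⟩
  · rw [Measure.finsetSum_apply]
    refine Finset.sum_eq_zero fun z hz => ?_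
    obtain ⟨t, ht, rfl⟩ := Finset.mem_image.mp hz
    rw [Measure.smul_apply, Measure.dirac_apply, Set.indicator_of_notMem, smul_zero]
    rw [Set.notMem_compl_iff]
    change (t ^ 3) ^ 2 = (t ^ 2) ^ 3
    ring
  · obtain ⟨h1, h2⟩ := integral_atomic s (w := fun z => w (cuspParam z)) hpos
      fun z => z.1 ^ i * z.2 ^ j
    refine ⟨h1, ?_⟩
    rw [h2, hs, Finset.sum_image hinj.injOn, h.2 i j hij]
    refine Finset.sum_congr rfl fun t _ => ?_
    rw [cuspParam_mk, pow_add, pow_mul, pow_mul]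

/-- Each atom contributes a matrix of rank at most one; these are the lower bounds behind
minimality. -/
lemma rank_le_of_mem_atomCounts (hk : 1 ≤ k) {n : ℕ} (h : n ∈ atomCounts β k) :
    (momentMatrix β k).rank ≤ n ∧ (ATilde β k).rank ≤ n := by
  obtain ⟨μ, hμ, s, w, rfl, hw, rfl⟩ := h
  obtain ⟨c, hc⟩ := hμ.exists_gam hk
  have hsum : ∀ a b : ℕ, a + b ≤ 6 * k → gam β c (a + b) =
      ∑ z ∈ s, (w z * cuspParam z ^ a) * cuspParam z ^ b := by
    intro a b hab
    rw [(hc _ hab).2, (integral_atomic s hw _).2]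
    refine Finset.sum_congr rfl fun z _ => ?_
    rw [pow_add, mul_assoc]
  constructor
  · rw [momentMatrix_eq_gram (hμ.factorsThroughCusp hk) c]
    refine rank_le_card s (fun z a => w z * cuspParam z ^ cuspExp a)
      (fun z b => cuspParam z ^ cuspExp b) fun a b => hsum _ _ ?_
    have := cuspExp_le a
    have := cuspExp_le b
    omega
  · rw [ATilde_eq_gram β k c]
    exact rank_le_card s (fun z a => w z * cuspParam z ^ ((a : ℕ) + 1))
      (fun z b => cuspParam z ^ ((b : ℕ) + 1)) fun a b => hsum _ _ (by dsimp only; omega)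

lemma IsAtomicRep.exists_gam {T : Finset ℝ} {w : ℝ → ℝ} (h : IsAtomicRep β k T w) :
    FactorsThroughCusp β k ∧ ∃ c, ∀ n ≤ 6 * k, gam β c n = ∑ t ∈ T, w t * t ^ n := by
  have h1 : ∀ c n, n ≤ 6 * k → n ≠ 1 → gam β c n = ∑ t ∈ T, w t * t ^ n := by
    intro c n hn hn1
    obtain ⟨i, j, hij, hi, rfl⟩ := exists_exponents (k := 2 * k) (by omega) hn1
    rw [gam_eq_of_le_two β c hi, h.2 i j hij]
  refine ⟨fun c i j hij => ?_, ∑ t ∈ T, w t * t ^ 1, fun n hn => ?_⟩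
  · rw [h1 c _ (by omega) (two_mul_add_three_mul_ne_one i j), h.2 i j hij]
  · by_cases hn1 : n = 1
    · rw [hn1, gam_one]
    · exact h1 _ n hn hn1

/-- Positive powers of `t` do not see an atom at `0`, whereas the constant monomial in `M(k)` does.
-/
lemma IsAtomicRep.ranks {T : Finset ℝ} {w : ℝ → ℝ} (h : IsAtomicRep β k T w)
    (hT : (T.erase 0).card < 3 * k) :
    (AHat β k).rank = (T.erase 0).card ∧ (ATilde β k).rank = (T.erase 0).card ∧
      (ABreve β k).rank = (T.erase 0).card ∧ (momentMatrix β k).rank = T.card ∧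
      rankTilde β k = (T.erase 0).card := by
  obtain ⟨hβ, c, hc⟩ := h.exists_gam
  have hw : ∀ t ∈ T.erase 0, 0 < w t := fun t ht => h.1 t (Finset.mem_of_mem_erase ht)
  have h0 : (0 : ℝ) ∉ T.erase 0 := Finset.notMem_erase 0 T
  have hc' : ∀ n ≤ 6 * k, n ≠ 0 → gam β c n = ∑ t ∈ T.erase 0, w t * t ^ n := by
    intro n hn hn0
    rw [hc n hn, Finset.sum_erase]
    rw [zero_pow hn0, mul_zero]
  refine ⟨?_, ?_, ?_, ?_, ?_⟩
  · rw [AHat_eq_gram β k c]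
    exact rank_gram_shift hw h0 (by omega) fun a b => hc' _ (by omega) (by omega)
  · rw [ATilde_eq_gram β k c]
    exact rank_gram_shift hw h0 (by omega) fun a b => hc' _ (by omega) (by omega)
  · rw [ABreve_eq_gram β k c]
    exact rank_gram_shift hw h0 (by omega) fun a b => hc' _ (by omega) (by omega)
  · rw [momentMatrix_eq_gram hβ c]
    refine rank_gram_eq_card h.1 (fun a b => hc _ ?_) fun r => ?_
    · have := cuspExp_le a
      have := cuspExp_le b
      omega
    -- The interpolant `r 0 + X ^ 2 * g` has no linear term, and `(T.erase 0).card < 3 * k` keeps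
    -- its degree at most `3k`.
    · obtain ⟨g, hg, hgr⟩ := exists_eval_X_pow_mul_eq h0 2 fun t => r t - r 0
      have hcoeff : ∀ n, (C (r 0) + X ^ 2 * g).coeff n ≠ 0 → n = 0 ∨ 2 ≤ n ∧ n ≤ 3 * k := by
        intro n hn
        by_cases hn0 : n = 0
        · exact Or.inl hn0
        · rw [coeff_add, coeff_C_of_ne_zero hn0, zero_add] at hn
          obtain ⟨m, hm, rfl⟩ := mem_support_X_pow_mul (mem_support_iff.mpr hn)
          have := hg m hm
          omega
      obtain ⟨v, hv⟩ := exists_expPoly_cuspExp (k := k) (f := C (r 0) + X ^ 2 * g)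
        (natDegree_le_of_support fun n hn => by
          have := hcoeff n (mem_support_iff.mp hn); omega)
        (by by_contra h1; have := hcoeff 1 h1; omega)
      refine ⟨v, fun t ht => ?_⟩
      rw [hv, eval_add, eval_C]
      by_cases ht0 : t = 0
      · simp [ht0]
      · rw [hgr t (Finset.mem_erase.mpr ⟨ht0, ht⟩)]
        ring
  -- `conc` starts at the moment of order `2`, so its weights carry a factor `t ^ 2`.
  · refine seqRank_eq_card (w := fun t => w t * t ^ 2)
      (fun t ht => mul_pos (hw t ht) ?_) (fun n hn => ?_) (by omega)
    · have : t ≠ 0 := Finset.ne_of_mem_erase ht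
      positivity
    · rw [← gam_add_two β c, hc' _ (by omega) (by omega)]
      exact Finset.sum_congr rfl fun t _ => by ring

end CuspTMP
end

noncomputable section

namespace CuspTMP

open Polynomial

variable {β : ℕ → ℕ → ℝ} {k : ℕ}

/-! ### Atomic representations in the singular case -/

/-- The rank of the selected columns lies between the two equal ranks, so these columns already span
the column space. -/
lemma col_mem_span_of_rank_submatrix_eq {m n m' n' : Type*} [Fintype m] [Fintype n] [Fintype m']
    [Fintype n'] (H : Matrix m n ℝ) (r : m' → m) (e : n' → n)
    (h : (H.submatrix r e).rank = H.rank) (j : n) :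
    H.col j ∈ Submodule.span ℝ (Set.range fun b => H.col (e b)) := by
  have hK : (H.submatrix id e).rank = H.rank := by
    refine le_antisymm (Matrix.rank_submatrix_le H id e) ?_
    rw [← h]
    exact Matrix.rank_submatrix_le (H.submatrix id e) r id
  rw [Matrix.rank_eq_finrank_span_cols, Matrix.rank_eq_finrank_span_cols] at hK
  have hcol : (H.submatrix id e).col = fun b => H.col (e b) := rfl
  rw [hcol] at hK
  have hle : Submodule.span ℝ (Set.range fun b => H.col (e b)) ≤
      Submodule.span ℝ (Set.range H.col) :=
    Submodule.span_mono (by rintro _ ⟨b, rfl⟩; exact ⟨e b, rfl⟩)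
  rw [Submodule.eq_of_le_of_finrank_eq hle hK]
  exact Submodule.subset_span ⟨j, rfl⟩

lemma exists_last_relation {s : ℕ → ℝ} {N : ℕ}
    (h : (hankel s N).rank = (hankel s (N + 1)).rank) :
    ∃ g : ℝ[X], g.degree < (N + 1 : ℕ) ∧ hankelColMap s (N + 1) (X ^ (N + 1) - g) = 0 := by
  rw [← hankelCol_mem_span_iff]
  have h1 := col_mem_span_of_rank_submatrix_eq (hankel s (N + 1)) Fin.castSucc Fin.castSucc h
    (Fin.last _)
  have h2 : ∀ j : Fin (N + 1 + 1), (hankel s (N + 1)).col j = hankelCol s (N + 1) j := by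
    intro j
    ext l
    simp [Matrix.col, hankel, hankelCol, add_comm]
  simp only [h2, Fin.val_last, Fin.val_castSucc] at h1
  refine Submodule.span_mono ?_ h1
  rintro _ ⟨b, rfl⟩
  exact ⟨b, b.2, rfl⟩

/-- Deleting the first row and column keeps the rank, so column `0` depends on the others. The
resulting kernel polynomial excludes an atom at `0`. -/
lemma exists_first_relation {s : ℕ → ℝ} {N : ℕ}
    (h : (hankel (fun m => s (m + 2)) N).rank = (hankel s (N + 1)).rank) :
    ∃ q : ℝ[X], q.natDegree ≤ N + 1 ∧ q.eval 0 = 1 ∧ hankelColMap s (N + 1) q = 0 := by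
  have h0 : hankel (fun m => s (m + 2)) N = (hankel s (N + 1)).submatrix Fin.succ Fin.succ := by
    ext a b
    simp only [hankel, Matrix.of_apply, Matrix.submatrix_apply, Fin.val_succ]
    congr 1
    ring
  rw [h0] at h
  have h1 := col_mem_span_of_rank_submatrix_eq _ _ _ h 0
  rw [Submodule.mem_span_range_iff_exists_fun] at h1
  obtain ⟨c, hc⟩ := h1
  refine ⟨1 - expPoly (fun a : Fin (N + 1) => (a : ℕ) + 1) c, ?_, ?_, ?_⟩
  · refine (natDegree_sub_le _ _).trans (max_le (by simp) ?_)
    refine natDegree_le_of_support fun n hn => ?_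
    obtain ⟨a, rfl⟩ := exists_of_mem_support_expPoly hn
    omega
  · simp [eval_expPoly]
  · rw [map_sub, sub_eq_zero]
    have h2 : hankelColMap s (N + 1) 1 = (hankel s (N + 1)).col 0 := by
      rw [← pow_zero X, hankelColMap_X_pow]
      ext l
      simp [Matrix.col, hankel, hankelCol]
    rw [h2, ← hc, expPoly, map_sum]
    refine Finset.sum_congr rfl fun b _ => ?_
    rw [← smul_eq_C_mul, map_smul, hankelColMap_X_pow]
    congr 1
    ext l
    simp [Matrix.col, hankel, hankelCol, add_comm]

/-- In the singular case the moments of order at least two are those of a measure with nonzero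
atoms, and the positivity of the moment matrix leaves a nonnegative mass at the origin. -/
theorem exists_isAtomicRep_of_rank_eq (hk : 1 ≤ k) (hM : (momentMatrix β k).PosSemidef)
    (hβ : FactorsThroughCusp β k) (hA : (ATilde β k).PosSemidef)
    (h1 : (AHat β k).rank = (ATilde β k).rank) (h2 : (ATilde β k).rank = (ABreve β k).rank) :
    ∃ T w, IsAtomicRep β k T w := by
  classical
  obtain ⟨N, hN⟩ : ∃ N, 3 * k - 2 = N := ⟨_, rfl⟩
  have hN' : 3 * k - 1 = N + 1 := by omega
  rw [AHat, ATilde, hN, hN'] at h1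
  rw [ABreve, ATilde, hN, hN'] at h2
  rw [ATilde, hN'] at hA
  obtain ⟨g, hg, hgker⟩ := exists_last_relation h1
  obtain ⟨q, hqd, hq0, hqker⟩ := exists_first_relation h2.symm
  have hpd : (X ^ (N + 1) - g).natDegree = N + 1 := natDegree_eq_of_degree_eq_some (by
    rw [degree_sub_eq_left_of_degree_lt (by rwa [degree_X_pow]), degree_X_pow])
  have hmonic := monic_X_pow_sub (n := N + 1) hg
  obtain ⟨T, w, hw, hTp, hT⟩ := exists_quadrature_of_natDegree_le (γ := conc β) (D := N + 1)
    (fun f hf => riesz_mul_self_nonneg (ex := fun a : Fin (N + 1 + 1) => (a : ℕ))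
      Fin.val_injective hA fun n hn =>
        ⟨⟨n, by have := (le_natDegree_of_mem_supp n hn).trans hf; omega⟩, rfl⟩)
    hmonic hpd
    (fun j hj => congrFun hgker ⟨j, by omega⟩)
  have hTcard : T.card ≤ N + 1 := by
    rw [← hpd]
    exact card_le_degree_of_subset_roots fun t ht =>
      (mem_roots hmonic.ne_zero).mpr (hTp t (by simpa using ht))
  have hT0 : (0 : ℝ) ∉ T := by
    intro h0
    have h3 : riesz (conc β) (q * q) = 0 := riesz_mul_eq_zero (D := N + 1)
      (fun j hj => congrFun hqker ⟨j, by omega⟩) hqd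
    rw [riesz_eq_sum_eval (T := T) (w := w) fun n hn =>
      hT n ((le_natDegree_of_mem_supp n hn).trans (natDegree_mul_le.trans (by omega)))] at h3
    have h4 := eval_eq_zero_of_sum_eq_zero hw h3 0 h0
    rw [hq0] at h4
    exact one_ne_zero h4
  have hne : ∀ t ∈ T, t ≠ 0 := fun t ht h => hT0 (h ▸ ht)
  -- Dividing the weights by `t ^ 2` undoes the shift by two; `ρ` is the mass still missing from `β
  -- 0 0`, to be placed at `0`.
  set ρ := β 0 0 - ∑ t ∈ T, w t / t ^ 2 with hρ
  set w' : ℝ → ℝ := fun t => if t = 0 then ρ else w t / t ^ 2 with hw'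
  have hw'T : ∀ t ∈ T, w' t = w t / t ^ 2 := fun t ht => if_neg (hne t ht)
  have hw'0 : w' 0 = ρ := if_pos rfl
  have hgam : ∀ n ≤ 6 * k, gam β (∑ t ∈ T, w' t * t) n =
      ∑ t ∈ insert 0 T, w' t * t ^ n := by
    intro n hn
    rw [Finset.sum_insert hT0, hw'0]
    match n, hn with
    | 0, _ =>
      rw [gam_zero, hρ]
      simp only [pow_zero, mul_one]
      rw [Finset.sum_congr rfl hw'T]
      ring
    | 1, _ => simp [gam_one]
    | n + 2, hn =>
      rw [gam_add_two, hT n (by omega), zero_pow (by omega), mul_zero, zero_add]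
      refine Finset.sum_congr rfl fun t ht => ?_
      rw [hw'T t ht]
      have := hne t ht
      field_simp
      ring
  have hρ0 : 0 ≤ ρ := by
    -- `1 + X ^ 2 * r` vanishes on `T`, equals `1` at `0` and has no linear term, so `M(k)`
    -- evaluates its square as `ρ`.
    obtain ⟨r, hr, hrT⟩ := exists_eval_X_pow_mul_eq hT0 2 fun _ => -1
    have hcoeff : ∀ n, (1 + X ^ 2 * r).coeff n ≠ 0 → n = 0 ∨ 2 ≤ n ∧ n ≤ 3 * k := by
      intro n hn
      by_cases hn0 : n = 0
      · exact Or.inl hn0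
      · rw [coeff_add, ← C_1, coeff_C_of_ne_zero hn0, zero_add] at hn
        obtain ⟨m, hm, rfl⟩ := mem_support_X_pow_mul (mem_support_iff.mpr hn)
        have := hr m hm
        omega
    have hQd : (1 + X ^ 2 * r).natDegree ≤ 3 * k := natDegree_le_of_support fun n hn => by
      have := hcoeff n (mem_support_iff.mp hn); omega
    have h3 := riesz_mul_self_nonneg_of_momentMatrix hβ hM (∑ t ∈ T, w' t * t) hQd
      (by by_contra h; have := hcoeff 1 h; omega)
    rw [riesz_eq_sum_eval (T := insert 0 T) (w := w') fun n hn => hgam n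
      ((le_natDegree_of_mem_supp n hn).trans (natDegree_mul_le.trans (by omega))),
      Finset.sum_insert hT0, Finset.sum_eq_zero, hw'0] at h3
    · simpa using h3
    · intro t ht
      rw [eval_mul, eval_add, hrT t ht, eval_one]
      simp
  have hw'nonneg : ∀ t ∈ insert 0 T, 0 ≤ w' t := by
    intro t ht
    rcases Finset.mem_insert.mp ht with rfl | ht
    · rwa [hw'0]
    · rw [hw'T t ht]
      exact div_nonneg (hw t ht).le (sq_nonneg t)
  refine ⟨{t ∈ insert 0 T | 0 < w' t}, w', isAtomicRep_of_gam (c := ∑ t ∈ T, w' t * t) hβ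
    (fun t ht => (Finset.mem_filter.mp ht).2) fun n hn => ?_⟩
  rw [hgam n hn, Finset.sum_filter]
  refine Finset.sum_congr rfl fun t ht => ?_
  split_ifs with h
  · rfl
  · rw [le_antisymm (not_lt.mp h) (hw'nonneg t ht), zero_mul]

/-! ### Atomic representations in the positive definite case -/

lemma riesz_gam (β : ℕ → ℕ → ℝ) (c : ℝ) (f : ℝ[X]) :
    riesz (gam β c) f = riesz (gam β 0) f + c * f.coeff 1 := by
  induction f using Polynomial.induction_on' with
  | add p q hp hq => rw [map_add, map_add, hp, hq, coeff_add]; ring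
  | monomial n a =>
    rw [← C_mul_X_pow_eq_monomial, ← smul_eq_C_mul, map_smul, map_smul, riesz_X_pow, riesz_X_pow,
      coeff_smul, coeff_X_pow]
    match n with
    | 0 => simp [gam_zero]
    | 1 => simp [gam_one]; ring
    | n + 2 => simp [gam_add_two]

lemma riesz_mul_eq_zero_of_support {γ : ℕ → ℝ} {e f : ℝ[X]}
    (h : ∀ n ∈ f.support, riesz γ (e * X ^ n) = 0) : riesz γ (e * f) = 0 := by
  conv_lhs => rw [f.as_sum_support_C_mul_X_pow]
  rw [Finset.mul_sum, map_sum]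
  refine Finset.sum_eq_zero fun n hn => ?_
  rw [mul_left_comm, ← smul_eq_C_mul, map_smul, h n hn, smul_zero]

lemma exists_dual_of_gram_posDef {γ : ℕ → ℝ} {N e : ℕ}
    (hG : (gram γ fun a : Fin N => (a : ℕ) + e).PosDef) (τ : ℕ → ℝ) :
    ∃ f : ℝ[X], (∀ n ∈ f.support, e ≤ n ∧ n < N + e) ∧
      ∀ j, e ≤ j → j < N + e → riesz γ (f * X ^ j) = τ j := by
  set G := gram γ fun a : Fin N => (a : ℕ) + e with hGdef
  have hdet := (Matrix.isUnit_iff_isUnit_det G).mp hG.isUnit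
  refine ⟨expPoly (fun a : Fin N => (a : ℕ) + e)
    (G⁻¹.mulVec fun a : Fin N => τ ((a : ℕ) + e)), fun n hn => ?_, fun j hj hj' => ?_⟩
  · obtain ⟨a, rfl⟩ := exists_of_mem_support_expPoly hn
    omega
  · have h1 := gram_mulVec γ (fun a : Fin N => (a : ℕ) + e)
      (G⁻¹.mulVec fun a : Fin N => τ ((a : ℕ) + e)) ⟨j - e, by omega⟩
    rw [← hGdef, Matrix.mulVec_mulVec, Matrix.mul_nonsing_inv _ hdet, Matrix.one_mulVec] at h1
    simp only [Nat.sub_add_cancel hj] at h1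
    exact h1.symm

/-- A positive functional on polynomials of degree at most `d` extending the one given by `β`,
with a polynomial of degree exactly `d` in its kernel: the moment of order `1` is chosen at an
end of the interval of admissible values. -/
lemma exists_singular_completion (hk : 1 ≤ k) (hM : (momentMatrix β k).PosSemidef)
    (hβ : FactorsThroughCusp β k) (hA : (ATilde β k).PosDef) (hB : (tildeA β k).PosDef) :
    ∃ c, (∀ f : ℝ[X], f.natDegree ≤ 3 * k → 0 ≤ riesz (gam β c) (f * f)) ∧
      ∃ p : ℝ[X], p.Monic ∧ p.natDegree = 3 * k ∧
        ∀ f : ℝ[X], f.natDegree ≤ 3 * k → riesz (gam β c) (p * f) = 0 := by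
  set L := riesz (gam β 0) with hL
  have hApos : ∀ f : ℝ[X], (∀ n ∈ f.support, 1 ≤ n ∧ n ≤ 3 * k) → f ≠ 0 → 0 < L (f * f) := by
    rw [ATilde_eq_gram β k 0] at hA
    exact fun f hf hf0 => riesz_mul_self_pos (add_injective _ _) hA
      (fun n hn => ⟨⟨n - 1, by have := hf n hn; omega⟩, by have := hf n hn; dsimp only; omega⟩) hf0
  have hBpos : ∀ f : ℝ[X], (∀ n ∈ f.support, n ≠ 1 ∧ n < 3 * k) → f ≠ 0 → 0 < L (f * f) := by
    rw [tildeA_eq_gram β k 0] at hB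
    refine fun f hf hf0 => riesz_mul_self_pos (tildeA_exp_injective _) hB (fun n hn => ?_) hf0
    have := hf n hn
    by_cases hn0 : n = 0
    · exact ⟨Sum.inl (), hn0.symm⟩
    · exact ⟨Sum.inr ⟨n - 2, by omega⟩, by simp only [Sum.elim_inr]; omega⟩
  have hG : (gram (gam β 0) fun a : Fin (3 * k - 1) => (a : ℕ) + 2).PosDef :=
    gram_posDef (add_injective _ _) fun f hf hf0 => hApos f (fun n hn => by
      obtain ⟨a, rfl⟩ := hf n hn
      omega) hf0
  -- `r₀` and `r₁` are the orthogonal projections of `1` and `X` onto the span of `X ^ 2, …, X ^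
  -- (3k)`. With the remainders `e₀`, `e₁`, only the pairing of `e₀` with `e₁` depends on `c`.
  obtain ⟨r₀, hr₀, hr₀L⟩ := exists_dual_of_gram_posDef hG fun j => L (X ^ j)
  obtain ⟨r₁, hr₁, hr₁L⟩ := exists_dual_of_gram_posDef hG fun j => L (X * X ^ j)
  have hcoeff : ∀ {r : ℝ[X]}, (∀ n ∈ r.support, 2 ≤ n ∧ n < 3 * k - 1 + 2) →
      ∀ n, n < 2 ∨ 3 * k < n → r.coeff n = 0 := fun hr n hn => by
    by_contra h
    have := hr n (mem_support_iff.mpr h)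
    omega
  set e₀ := 1 - r₀ with he₀
  set e₁ := X - r₁ with he₁
  have he₀L : ∀ j, 2 ≤ j → j ≤ 3 * k → L (e₀ * X ^ j) = 0 := fun j hj hj' => by
    rw [he₀, sub_mul, one_mul, map_sub, hr₀L j hj (by omega), sub_self]
  have he₁L : ∀ j, 2 ≤ j → j ≤ 3 * k → L (e₁ * X ^ j) = 0 := fun j hj hj' => by
    rw [he₁, sub_mul, map_sub, hr₁L j hj (by omega), sub_self]
  have he₀0 : e₀.coeff 0 = 1 := by simp [he₀, hcoeff hr₀ 0 (by omega)]
  have he₀1 : e₀.coeff 1 = 0 := by simp [he₀, hcoeff hr₀ 1 (by omega), coeff_one]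
  have he₁0 : e₁.coeff 0 = 0 := by simp [he₁, hcoeff hr₁ 0 (by omega)]
  have he₁1 : e₁.coeff 1 = 1 := by simp [he₁, hcoeff hr₁ 1 (by omega)]
  have he₀d : ∀ n, 3 * k < n → e₀.coeff n = 0 := fun n hn => by
    simp [he₀, hcoeff hr₀ n (by omega), coeff_one, show n ≠ 0 by omega]
  have he₁d : ∀ n, 3 * k < n → e₁.coeff n = 0 := fun n hn => by
    simp [he₁, hcoeff hr₁ n (by omega), coeff_X, show 1 ≠ n by omega]
  have he₀ne : e₀ ≠ 0 := fun h => by simp [h] at he₀0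
  have he₁ne : e₁ ≠ 0 := fun h => by simp [h] at he₁1
  have hα : 0 ≤ L (e₀ * e₀) := riesz_mul_self_nonneg_of_momentMatrix hβ hM 0
    (natDegree_le_iff_coeff_eq_zero.mpr he₀d) he₀1
  have hδ : 0 < L (e₁ * e₁) := hApos e₁ (fun n hn => by
    have h := mem_support_iff.mp hn
    refine ⟨?_, ?_⟩
    · by_contra h'
      obtain rfl : n = 0 := by omega
      exact h he₁0
    · by_contra h'
      exact h (he₁d n (by omega))) he₁ne
  -- a polynomial of low degree orthogonal to `X ^ 2, …, X ^ (3 * k)` vanishes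
  have hlow : ∀ e : ℝ[X], (∀ j, 2 ≤ j → j ≤ 3 * k → L (e * X ^ j) = 0) →
      (∀ n, 3 * k - 2 < n → e.coeff n = 0) → e = 0 := by
    intro e he hed
    have hsup : ∀ n ∈ e.support, n ≤ 3 * k - 2 := fun n hn => by
      by_contra h
      exact mem_support_iff.mp hn (hed n (by omega))
    by_contra he0
    have h1 := hApos (X ^ 1 * e) (fun n hn => by
      obtain ⟨m, hm, rfl⟩ := mem_support_X_pow_mul hn
      have := hsup m hm
      omega) (mul_ne_zero (pow_ne_zero _ X_ne_zero) he0)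
    -- The right factor `X ^ 2 * e` has exponents in `2, …, 3k`, so orthogonality applies.
    have h2 : X ^ 1 * e * (X ^ 1 * e) = e * (X ^ 2 * e) := by ring
    rw [h2] at h1
    refine h1.ne' (riesz_mul_eq_zero_of_support fun n hn => ?_)
    obtain ⟨m, hm, rfl⟩ := mem_support_X_pow_mul hn
    have := hsup m hm
    exact he _ (by omega) (by omega)
  set a := √(L (e₀ * e₀)) with ha
  set b := √(L (e₁ * e₁)) with hb
  have haa : a * a = L (e₀ * e₀) := Real.mul_self_sqrt hα
  have hbb : b * b = L (e₁ * e₁) := Real.mul_self_sqrt hδ.le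
  have hb0 : b ≠ 0 := (Real.sqrt_pos.mpr hδ).ne'
  -- The form on `e₀, e₁` is singular when its off-diagonal entry is `ε * a * b` with `ε = ±1`; the
  -- kernel is then spanned by `b • e₀ - (ε * a) • e₁` since `b ≠ 0`. One sign gives degree exactly
  -- `3k`.
  obtain ⟨ε, hε, hlead⟩ : ∃ ε : ℝ, ε * ε = 1 ∧
      b * e₀.coeff (3 * k) - ε * a * e₁.coeff (3 * k) ≠ 0 := by
    by_contra! hcon
    have h1 := hcon 1 (by norm_num)
    have h2 := hcon (-1) (by norm_num)
    have h3 : e₀.coeff (3 * k) = 0 := by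
      have : b * e₀.coeff (3 * k) = 0 := by linarith
      exact (mul_eq_zero.mp this).resolve_left hb0
    -- Here definiteness of `tildeA` enters: without its top coefficient, `e₀` lies in the span of
    -- `1, X ^ 2, …, X ^ (3k - 1)`.
    have h4 : 0 < L (e₀ * e₀) := hBpos e₀ (fun n hn => by
      have h := mem_support_iff.mp hn
      refine ⟨fun h' => h (h' ▸ he₀1), ?_⟩
      by_contra h'
      rcases (not_lt.mp h').eq_or_lt with h'' | h''
      · exact h (h'' ▸ h3)
      · exact h (he₀d n h'')) he₀ne
    have ha0 : a ≠ 0 := (Real.sqrt_pos.mpr h4).ne'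
    have h5 : e₁.coeff (3 * k) = 0 := by
      have : a * e₁.coeff (3 * k) = 0 := by linarith
      exact (mul_eq_zero.mp this).resolve_left ha0
    -- This combination cancels the coefficient of `X ^ (3k - 1)`, so it vanishes; its constant term
    -- is `e₁.coeff (3 * k - 1)`, and then `e₁` itself has low degree.
    have h6 := hlow (C (e₁.coeff (3 * k - 1)) * e₀ - C (e₀.coeff (3 * k - 1)) * e₁)
      (fun j hj hj' => by
        rw [sub_mul, mul_assoc, mul_assoc, ← smul_eq_C_mul, ← smul_eq_C_mul, map_sub, map_smul,
          map_smul, he₀L j hj hj', he₁L j hj hj', smul_zero, smul_zero, sub_zero])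
      (fun n hn => by
        rw [coeff_sub, coeff_C_mul, coeff_C_mul]
        obtain rfl | rfl | h : n = 3 * k - 1 ∨ n = 3 * k ∨ 3 * k < n := by omega
        · ring
        · rw [h3, h5]; ring
        · rw [he₀d n h, he₁d n h]; ring)
    have h7 : e₁.coeff (3 * k - 1) = 0 := by
      have := congrArg (fun f : ℝ[X] => f.coeff 0) h6
      simpa [he₀0, he₁0] using this
    exact he₁ne (hlow e₁ he₁L fun n hn => by
      obtain rfl | rfl | h : n = 3 * k - 1 ∨ n = 3 * k ∨ 3 * k < n := by omega
      · exact h7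
      · exact h5
      · exact he₁d n h)
  -- The coefficient of `X` in `e₀ * e₁` is `1`, so this `c` makes the off-diagonal entry `ε * a *
  -- b`.
  set c := ε * a * b - L (e₀ * e₁) with hc
  set Lc := riesz (gam β c) with hLc
  have hLcL : ∀ f, Lc f = L f + c * f.coeff 1 := riesz_gam β c
  have h00 : Lc (e₀ * e₀) = a * a := by
    rw [hLcL, mul_coeff_one, he₀1, haa]; ring
  have h11 : Lc (e₁ * e₁) = b * b := by
    rw [hLcL, mul_coeff_one, he₁0, hbb]; ring
  have h01 : Lc (e₀ * e₁) = ε * a * b := by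
    rw [hLcL, mul_coeff_one, he₀0, he₁1, he₀1, he₁0, hc]; ring
  have hdecomp : ∀ f : ℝ[X], f.natDegree ≤ 3 * k → ∃ (x y : ℝ) (r : ℝ[X]),
      f = x • e₀ + y • e₁ + r ∧ Lc (e₀ * r) = 0 ∧ Lc (e₁ * r) = 0 ∧ 0 ≤ Lc (r * r) := by
    intro f hf
    set r := f - (f.coeff 0 • e₀ + f.coeff 1 • e₁) with hr
    have hr0 : r.coeff 0 = 0 := by simp [hr, he₀0, he₁0]
    have hr1 : r.coeff 1 = 0 := by simp [hr, he₀1, he₁1]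
    have hrsup : ∀ n ∈ r.support, 2 ≤ n ∧ n ≤ 3 * k := fun n hn => by
      have h := mem_support_iff.mp hn
      constructor
      · by_contra h'
        obtain rfl | rfl : n = 0 ∨ n = 1 := by omega
        · exact h hr0
        · exact h hr1
      · by_contra h'
        refine h ?_
        simp [hr, he₀d n (by omega), he₁d n (by omega),
          coeff_eq_zero_of_natDegree_lt (show f.natDegree < n by omega)]
    have hLr : ∀ e : ℝ[X], Lc (e * r) = L (e * r) := fun e => by
      rw [hLcL, mul_coeff_one, hr0, hr1]; ring
    refine ⟨f.coeff 0, f.coeff 1, r, by rw [hr]; ring, ?_, ?_, ?_⟩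
    · rw [hLr]
      exact riesz_mul_eq_zero_of_support fun n hn => he₀L n (hrsup n hn).1 (hrsup n hn).2
    · rw [hLr]
      exact riesz_mul_eq_zero_of_support fun n hn => he₁L n (hrsup n hn).1 (hrsup n hn).2
    · rw [hLr]
      by_cases hr0 : r = 0
      · simp [hr0]
      · exact (hApos r (fun n hn => ⟨by have := hrsup n hn; omega, (hrsup n hn).2⟩) hr0).le
  refine ⟨c, ?_⟩
  rw [← hLc]
  refine ⟨fun f hf => ?_, ?_⟩
  · obtain ⟨x, y, r, rfl, h0r, h1r, hrr⟩ := hdecomp f hf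
    have h : (x • e₀ + y • e₁ + r) * (x • e₀ + y • e₁ + r) = (x * x) • (e₀ * e₀) +
        (2 * x * y) • (e₀ * e₁) + (y * y) • (e₁ * e₁) + (2 * x) • (e₀ * r) +
        (2 * y) • (e₁ * r) + r * r := by
      simp only [smul_eq_C_mul, C_mul, C_ofNat]; ring
    rw [h]
    simp only [map_add, map_smul, smul_eq_mul, h00, h11, h01, h0r, h1r]
    -- The singular two-by-two form is a perfect square because `ε * ε = 1`.
    have h' : x * x * (a * a) + 2 * x * y * (ε * a * b) + y * y * (b * b) =
        (x * a + ε * (y * b)) ^ 2 := by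
      linear_combination (-(y * y * (b * b))) * hε
    rw [h']
    have := sq_nonneg (x * a + ε * (y * b))
    linarith
  · set p := b • e₀ - (ε * a) • e₁ with hp
    have hpc : p.coeff (3 * k) ≠ 0 := by
      simpa [hp] using hlead
    have hpd : p.natDegree = 3 * k := by
      refine le_antisymm (natDegree_le_iff_coeff_eq_zero.mpr fun n hn => ?_)
        (le_natDegree_of_ne_zero hpc)
      simp [hp, he₀d n hn, he₁d n hn]
    have hp0 : p ≠ 0 := fun h => by simp [h] at hpc
    have hlc : p.leadingCoeff ≠ 0 := leadingCoeff_ne_zero.mpr hp0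
    refine ⟨p * C p.leadingCoeff⁻¹, monic_mul_leadingCoeff_inv hp0, ?_, fun f hf => ?_⟩
    · rw [natDegree_mul_C (inv_ne_zero hlc), hpd]
    · obtain ⟨x, y, r, rfl, h0r, h1r, -⟩ := hdecomp f hf
      have h : p * (x • e₀ + y • e₁ + r) = (b * x) • (e₀ * e₀) +
          (b * y - ε * a * x) • (e₀ * e₁) - (ε * a * y) • (e₁ * e₁) + b • (e₀ * r) -
          (ε * a) • (e₁ * r) := by
        simp only [hp, smul_eq_C_mul, C_mul, C_sub]; ring
      rw [mul_right_comm, mul_comm _ (C _), ← smul_eq_C_mul, map_smul, h]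
      simp only [map_add, map_sub, map_smul, smul_eq_mul, h00, h11, h01, h0r, h1r]
      linear_combination (-p.leadingCoeff⁻¹ * (a * a * b * x)) * hε

theorem exists_isAtomicRep_of_posDef (hk : 1 ≤ k) (hM : (momentMatrix β k).PosSemidef)
    (hβ : FactorsThroughCusp β k) (hA : (ATilde β k).PosDef) (hB : (tildeA β k).PosDef) :
    ∃ T w, IsAtomicRep β k T w ∧ T.card ≤ 3 * k := by
  obtain ⟨c, hpos, p, hp, hpd, hker⟩ := exists_singular_completion hk hM hβ hA hB
  obtain ⟨T, w, hw, hTp, hT⟩ := exists_quadrature_of_natDegree_le hpos hp hpd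
    (fun j hj => hker _ (by rw [natDegree_X_pow]; exact hj))
  refine ⟨T, w, isAtomicRep_of_gam hβ hw fun n hn => hT n (by omega), ?_⟩
  rw [← hpd]
  exact card_le_degree_of_subset_roots fun t ht =>
    (mem_roots hp.ne_zero).mpr (hTp t (by simpa using ht))

/-! ### The minimal number of atoms -/

lemma rank_ATilde_of_posDef (hk : 1 ≤ k) (hA : (ATilde β k).PosDef) :
    (ATilde β k).rank = 3 * k := by
  rw [Matrix.rank_of_isUnit _ hA.isUnit, Fintype.card_fin]
  omega

lemma rankTilde_of_posDef (hk : 1 ≤ k) (hA : (ATilde β k).PosDef) : rankTilde β k = 3 * k := by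
  have h : (hankel (conc β) (3 * k - 1)).det ≠ 0 := hA.det_pos.ne'
  rw [rankTilde, seqRank, if_pos h]
  omega

lemma isLeast_atomCounts_of_posDef (hk : 1 ≤ k) (hM : (momentMatrix β k).PosSemidef)
    (hβ : FactorsThroughCusp β k) (hA : (ATilde β k).PosDef) (hB : (tildeA β k).PosDef) :
    IsLeast (atomCounts β k) (rankTilde β k) := by
  obtain ⟨T, w, hT, hcard⟩ := exists_isAtomicRep_of_posDef hk hM hβ hA hB
  have hlow : ∀ n ∈ atomCounts β k, 3 * k ≤ n := fun n hn => by
    rw [← rank_ATilde_of_posDef hk hA]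
    exact (rank_le_of_mem_atomCounts hk hn).2
  rw [rankTilde_of_posDef hk hA]
  refine ⟨?_, hlow⟩
  rw [le_antisymm (hlow _ hT.card_mem_atomCounts) hcard]
  exact hT.card_mem_atomCounts

lemma IsAtomicRep.isLeast {T : Finset ℝ} {w : ℝ → ℝ} (hk : 1 ≤ k) (h : IsAtomicRep β k T w)
    (hT : (T.erase 0).card < 3 * k) : IsLeast (atomCounts β k) T.card := by
  refine ⟨h.card_mem_atomCounts, fun n hn => ?_⟩
  rw [← (h.ranks hT).2.2.2.1]
  exact (rank_le_of_mem_atomCounts hk hn).1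

end CuspTMP
end

/-! ### The characterization and the minimal number of atoms -/

theorem corollary4p4 (k : ℕ) (hk : 1 ≤ k) (β : ℕ → ℕ → ℝ)
    (hpsd : (CuspTMP.momentMatrix β k).PosSemidef)
    (hrg : CuspTMP.RecursivelyGenerated β k) :
    ((∃ μ : MeasureTheory.Measure (ℝ × ℝ), CuspTMP.IsRepMeasure β k CuspTMP.cusp μ) ↔
      ((3 ≤ k ∧ CuspTMP.colVec β k CuspTMP.cuspPoly = 0) ∨
        (k = 2 ∧ β 0 2 = β 3 0 ∧ β 1 2 = β 4 0 ∧ β 0 3 = β 3 1) ∨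
        k = 1) ∧
      (((CuspTMP.ATilde β k).PosDef ∧ (CuspTMP.tildeA β k).PosDef) ∨
        ((CuspTMP.ATilde β k).PosSemidef ∧
          (CuspTMP.AHat β k).rank = (CuspTMP.ATilde β k).rank ∧
          (CuspTMP.ATilde β k).rank = (CuspTMP.ABreve β k).rank))) ∧
    ((∃ μ : MeasureTheory.Measure (ℝ × ℝ), CuspTMP.IsRepMeasure β k CuspTMP.cusp μ) →
      ((((CuspTMP.ATilde β k).PosDef ∧ (CuspTMP.tildeA β k).PosDef) ∨
          ((CuspTMP.ATilde β k).PosSemidef ∧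
            (CuspTMP.AHat β k).rank = (CuspTMP.ATilde β k).rank ∧
            (CuspTMP.ATilde β k).rank = (CuspTMP.ABreve β k).rank ∧
            (CuspTMP.AHat β k).rank = (CuspTMP.momentMatrix β k).rank)) →
        IsLeast (CuspTMP.atomCounts β k) (CuspTMP.rankTilde β k)) ∧
      (¬ (((CuspTMP.ATilde β k).PosDef ∧ (CuspTMP.tildeA β k).PosDef) ∨
          ((CuspTMP.ATilde β k).PosSemidef ∧
            (CuspTMP.AHat β k).rank = (CuspTMP.ATilde β k).rank ∧
            (CuspTMP.ATilde β k).rank = (CuspTMP.ABreve β k).rank ∧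
            (CuspTMP.AHat β k).rank = (CuspTMP.momentMatrix β k).rank)) →
        IsLeast (CuspTMP.atomCounts β k) (CuspTMP.rankTilde β k + 1))) := by
  open CuspTMP in
  refine ⟨⟨?_, ?_⟩, ?_⟩
  · rintro ⟨μ, hμ⟩
    refine ⟨condition_of_factorsThroughCusp hk (hμ.factorsThroughCusp hk), ?_⟩
    by_cases hA : (ATilde β k).PosDef
    · exact Or.inl ⟨hA, hμ.tildeA_posDef hk hA⟩
    · obtain ⟨T, w, hT, hcard⟩ := hμ.exists_isAtomicRep hk hA
      obtain ⟨h1, h2, h3, -, -⟩ := hT.ranks hcard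
      exact Or.inr ⟨hμ.ATilde_posSemidef hk, h1.trans h2.symm, h2.trans h3.symm⟩
  · rintro ⟨hcond, hab⟩
    have hβ := factorsThroughCusp_of_condition hrg hcond
    obtain ⟨T, w, hT⟩ : ∃ T w, IsAtomicRep β k T w := by
      rcases hab with ⟨hA, hB⟩ | ⟨hA, h1, h2⟩
      · obtain ⟨T, w, hT, -⟩ := exists_isAtomicRep_of_posDef hk hpsd hβ hA hB
        exact ⟨T, w, hT⟩
      · exact exists_isAtomicRep_of_rank_eq hk hpsd hβ hA h1 h2
    obtain ⟨μ, hμ, -⟩ := hT.card_mem_atomCounts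
    exact ⟨μ, hμ⟩
  · rintro ⟨μ, hμ⟩
    by_cases hA : (ATilde β k).PosDef
    · have hB := hμ.tildeA_posDef hk hA
      exact ⟨fun _ => isLeast_atomCounts_of_posDef hk hpsd (hμ.factorsThroughCusp hk) hA hB,
        fun h => absurd (Or.inl ⟨hA, hB⟩) h⟩
    · obtain ⟨T, w, hT, hcard⟩ := hμ.exists_isAtomicRep hk hA
      obtain ⟨h1, h2, h3, h4, h5⟩ := hT.ranks hcard
      have hleast := hT.isLeast hk hcard
      rw [h1, h2, h3, h4, h5]
      refine ⟨?_, fun h => ?_⟩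
      · rintro (⟨hA', -⟩ | ⟨-, -, -, h⟩)
        · exact absurd hA' hA
        · rwa [h]
      -- Failure of the rank equality with `M(k)` means that the origin is an atom, which accounts
      -- for the additional `1`.
      · have hne : (T.erase 0).card ≠ T.card := fun h' =>
          h (Or.inr ⟨hμ.ATilde_posSemidef hk, rfl, rfl, h'⟩)
        have h0 : (0 : ℝ) ∈ T := by
          by_contra h0
          exact hne (by rw [Finset.erase_eq_of_notMem h0])
        rwa [Finset.card_erase_add_one h0]
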